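/- **Setting.** Let $\mathcal M=(\mathcal S,\mathcal A,\mathcal P,c,\gamma)$ be a Markov decision process with finite nonempty state and action spaces, costs $0\le c(s,a)\le 1$ and discount factor $\gamma\in(0,1)$. For a randomized stationary policy $\pi$ let $V^\pi(s)=\mathbb E[\sum_{t\ge0}\gamma^t c(S_t,A_t)\mid S_0=s]$, let $f_\vartheta(\pi)=\sum_s\vartheta(s)V^\pi(s)$ for a distribution $\vartheta$ on $\mathcal S$, and call $\pi^*$ optimal if $V^{\pi^*}(s)\le V^\pi(s)$ for all $s$ and $\pi$. A policy is interior if it gives positive probability to every action in every state. Write $M=1/(1-\gamma)$. *Divergence.* Let $w$ be strictly convex on the probability simplex $\Delta_{\mathcal A}$ and differentiable (relative to $\Delta_{\mathcal A}$) on its relative interior, and let $D^{\pi}_{\pi'}(s)=w(\pi(\cdot|s))-w(\pi'(\cdot|s))-\langle\nabla w(\pi'(\cdot|s)),\pi(\cdot|s)-\pi'(\cdot|s)\rangle$ for $\pi'$ interior. Assume (1) $D^\pi_{\pi'}(s)\ge\frac\mu2\|\pi(\cdot|s)-\pi'(\cdot|s)\|_1^2$ for some $\mu>0$; (2) from an interior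 policy, for any stepsize $\eta\ge0$ and any $Q\in\mathbb R^{\mathcal S\times\mathcal A}$, the update $\operatorname{argmin}_{p\in\Delta_{\mathcal A}}\{\eta\langle Q(s,\cdot),p\rangle+D^p_\pi(s)\}$ exists and is interior for every $s$; (3) for each $\mathfrak D>0$ there is $\tau(\mathfrak D)>0$ such that, for every state $s$, interior $\pi$ and deterministic optimal $\pi^*$ with $\pi^*(a|s)=1$, $(1-\gamma)D^{\pi^*}_\pi(s)\le\mathfrak D$ implies $\pi(a|s)\ge\tau(\mathfrak D)$. *Algorithm.* Given an interior $\pi_0$ (e.g. the uniform policy), a stepsize $\eta$, a length $n$ and a threshold $\tau$, iteration $t=0,\dots,k-1$ of SPMD with single-trajectory TOMC ($m=1$) follows $\pi_t$ from an arbitrary initial state-action pair (which may depend on the past) to collect one trajectory $(S_0,A_0),\dots,(S_{n-1},A_{n-1})$, with $S_{j+1}\sim\mathcal P(\cdot|S_j,A_j)$, $A_{j+1}\sim\pi_t(\cdot|S_{j+1})$. If $\pi_t(a|s)\ge\tau$, then $\hat Q_t(s,a)=\sum_{j=j_0}^{n-1}\gamma^{j-j_0}c(S_j,A_j)$, where $j_0$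 is the first visit time of $(s,a)$, and $\hat Q_t(s,a)=0$ if $(s,a)$ is not visited; if $\pi_t(a|s)<\tau$, then $\hat Q_t(s,a)=1/(1-\gamma)$. Then $\pi_{t+1}(\cdot|s)=\operatorname{argmin}_{p\in\Delta_{\mathcal A}}\{\eta\langle\hat Q_t(s,\cdot),p\rangle+D^p_{\pi_t}(s)\}$ for all $s$. *Mixing.* Let $C>0$, $\rho\in(0,1)$, $\underline\nu>0$. A run satisfies the mixing assumption if, almost surely, each of its policies $\pi_t$, $t<k$, has a stationary state distribution $\nu^{\pi_t}$ with $\nu^{\pi_t}(s)\ge\underline\nu$ for all $s$ and $\sum_s|\mathbb P^{\pi_t}(S_j=s|S_0=s_0)-\nu^{\pi_t}(s)|\le C\rho^{j+1}$ for all $s_0$ and $j\ge0$. *Parameters.* For $k\ge1$, $\delta\in(0,1)$ and $\mathcal D>0$ put $$Z=\tfrac{4\sqrt{\log(|\mathcal S|k/\delta)}}{1-\gamma},\quad \varepsilon=\tfrac{2}{1-\gamma}\sqrt{\tfrac{\log(|\mathcal S|k/\delta)}{k}},\quad \tau=\min\{\tau(\mathcal D),\tfrac1{|\mathcal A|}\},\quad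 \zeta^*=\min\Big\{\sqrt{\tfrac{2\mathcal D\mu}{(2+Z)M^2}},\tfrac{\mathcal D}{2+Z}\Big\},\quad \eta=\tfrac{\zeta^*}{\sqrt k},$$ $$H=\tfrac1{1-\gamma}+\tfrac{\max\{1,\lceil\log_\rho(\underline\nu\tau/(2C))\rceil\}}{\underline\nu\,\tau},\qquad L=\log\big(2+\tfrac{H|\mathcal A|}{\varepsilon}\big),$$ $$E=\tfrac{M^4(\zeta^*)^2}{4\mu^2(1-\gamma)^2}+\tfrac{\mathcal D^2}{(2+Z)^2(\zeta^*)^2(1-\gamma)^2},\qquad B=\tfrac{Z^2}{(1-\gamma)^2}+E .$$ **Theorem.** There are universal constants $K_1,K_2,K_3>0$ such that, for all data as above, every interior $\pi_0$ and every $\delta\in(0,1)$: (i) Let $k\ge1$, let $\mathcal D>0$ satisfy $\mathcal D\ge(2+Z)D^{\pi^*}_{\pi_0}(s)$ for all $s$ and all deterministic optimal $\pi^*$, and let $n\ge K_1HL$. Then every run of $k$ iterations with parameters $(\eta,n,\tau)$ that satisfies the mixing assumption has, with probability at least $1-\delta$, simultaneously for all $\vartheta$ and every optimal $\pi^*$,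 $$\min_{0\le t\le k-1}f_\vartheta(\pi_t)-f_\vartheta(\pi^*)\le\frac{\mathcal D}{(2+Z)\zeta^*(1-\gamma)\sqrt k}+\frac{\zeta^*M^2}{2\mu(1-\gamma)\sqrt k}+\frac{Z}{(1-\gamma)\sqrt k}.$$ Moreover, if $\epsilon>0$ and $k\ge K_2B/\epsilon^2$, then with probability at least $1-\delta$ the left-hand side is at most $\epsilon$, simultaneously for all $\vartheta$ and every optimal $\pi^*$. (ii) Let $D_0>0$ satisfy $D_0\ge D^{\pi^*}_{\pi_0}(s)$ for all $s$ and all deterministic optimal $\pi^*$, and let $\epsilon>0$. Then there is $k\ge1$ such that, with $\mathcal D=(2+Z)D_0$ and $n=\lceil K_1HL\rceil$, $$K_2\tfrac{B}{\epsilon^2}\le k\le K_3\max\{1,\tfrac{B}{\epsilon^2}\},\qquad nk\le K_3\,H\,L\,\max\{1,\tfrac{B}{\epsilon^2}\},$$ $$\log\tfrac{|\mathcal S|k}{\delta}\le K_3\log\Big(2+\tfrac{|\mathcal S|}{\delta}\Big(1+\tfrac{(1-\gamma)^{-4}+E}{\epsilon^2}\Big)\Big),$$ and every run of $k$ iterations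 with parameters $(\eta,n,\tau)$ that satisfies the mixing assumption has, with probability at least $1-\delta$, $\min_{t<k}f_\vartheta(\pi_t)-f_\vartheta(\pi^*)\le\epsilon$ simultaneously for all $\vartheta$ and every optimal $\pi^*$. Thus the total number of samples $nk$ is $\tilde{\mathcal O}(HB/\epsilon^2)$. -/

import Mathlib

open MeasureTheory

noncomputable section

namespace SPMD

/-- A finite discounted Markov decision process with costs in `[0, 1]`;
`trans s a s'` is the probability of moving to `s'` when action `a` is taken in state `s`. -/
structure MDP (S A : Type*) [Fintype S] where
  trans : S → A → S → ℝ
  trans_nonneg : ∀ s a s', 0 ≤ trans s a s'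
  trans_sum : ∀ s a, ∑ s', trans s a s' = 1
  cost : S → A → ℝ
  cost_nonneg : ∀ s a, 0 ≤ cost s a
  cost_le_one : ∀ s a, cost s a ≤ 1
  γ : ℝ
  γ_pos : 0 < γ
  γ_lt_one : γ < 1

/-- Randomized stationary policies: `(π s).1 a` is the probability of action `a` in state `s`. -/
abbrev Policy (S A : Type*) [Fintype A] := S → stdSimplex ℝ A

/-- The relative interior of the probability simplex. -/
def simplexInterior (A : Type*) [Fintype A] : Set (A → ℝ) :=
  {p | p ∈ stdSimplex ℝ A ∧ ∀ a, 0 < p a}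

/-- Policies in the relative interior of the set of all policies. -/
def Policy.IsInterior {S A : Type*} [Fintype A] (π : Policy S A) : Prop :=
  ∀ s, (π s).1 ∈ simplexInterior A

/-- Each state is assigned a single action with probability one. -/
def Policy.IsDeterministic {S A : Type*} [Fintype A] (π : Policy S A) : Prop :=
  ∀ s, ∃ a, (π s).1 a = 1

section MDP

variable {S A : Type*} [Fintype S] [DecidableEq S] [Fintype A]

/-- Transition matrix of the state chain induced by a policy. -/
def MDP.stateTrans (M : MDP S A) (π : Policy S A) : Matrix S S ℝ :=
  Matrix.of fun s s' => ∑ a, (π s).1 a * M.trans s a s'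

/-- The value function `E[∑ t, γ ^ t * c (S_t, A_t) | S_0 = s]`; the inner double sum is the
expectation of `c (S_t, A_t)` when the chain starts at `s` and follows `π`. -/
def MDP.value (M : MDP S A) (π : Policy S A) (s : S) : ℝ :=
  ∑' t : ℕ, M.γ ^ t * ∑ s', (M.stateTrans π ^ t) s s' * ∑ a, (π s').1 a * M.cost s' a

/-- The objective: the value function averaged over an initial distribution `ϑ`. -/
def MDP.objective (M : MDP S A) (ϑ : S → ℝ) (π : Policy S A) : ℝ :=
  ∑ s, ϑ s * M.value π s

/-- Optimal policies: they minimize the value function at every state simultaneously. -/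
def MDP.IsOptimal (M : MDP S A) (π : Policy S A) : Prop :=
  ∀ π' : Policy S A, ∀ s, M.value π s ≤ M.value π' s

/-- The state chain of `π` mixes geometrically with constants `(C, ρ)` to a stationary
distribution whose entries are all at least `νmin`. -/
def MDP.MixesWith (M : MDP S A) (π : Policy S A) (C ρ νmin : ℝ) : Prop :=
  ∃ ν ∈ stdSimplex ℝ S,
    (∀ s, ∑ s', ν s' * M.stateTrans π s' s = ν s) ∧
    (∀ s₀ : S, ∀ t : ℕ, ∑ s, |(M.stateTrans π ^ t) s₀ s - ν s| ≤ C * ρ ^ (t + 1)) ∧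
    ∀ s, νmin ≤ ν s

end MDP

/-- A distance-generating function on the simplex: strictly convex, and differentiable
(relative to the simplex) on the relative interior, where `grad p` is its derivative, regarded
as the linear functional `x ↦ ⟨∇w(p), x⟩`. -/
structure DistGen (A : Type*) [Fintype A] where
  w : (A → ℝ) → ℝ
  grad : (A → ℝ) → (A → ℝ) →L[ℝ] ℝ
  strictConvex : StrictConvexOn ℝ (stdSimplex ℝ A) w
  hasGrad : ∀ p ∈ simplexInterior A, HasFDerivWithinAt w (grad p) (stdSimplex ℝ A) p

section Bregman

variable {A : Type*} [Fintype A]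

/-- Bregman divergence `w x - w y - ⟨∇w(y), x - y⟩`, meaningful for `y` in the relative
interior; the divergence of policies `D^π_π'` at `s` is `bregman (π s) (π' s)`. -/
def DistGen.bregman (W : DistGen A) (x y : A → ℝ) : ℝ :=
  W.w x - W.w y - W.grad y (x - y)

/-- `x` solves the mirror descent subproblem
`min { η ⟨q, p⟩ + D(p, y) : p in the simplex }`. -/
def DistGen.IsProxStep (W : DistGen A) (η : ℝ) (q y x : A → ℝ) : Prop :=
  x ∈ stdSimplex ℝ A ∧
    IsMinOn (fun p : A → ℝ => η * ∑ a, q a * p a + W.bregman p y) (stdSimplex ℝ A) x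

variable {S : Type*} [Fintype S] [DecidableEq S]

/-- The requirements on the Bregman divergence: strong convexity in the `ℓ₁` norm with modulus
`μ`; updates from interior points are interior; and a lower bound `τ 𝔇` on the probability of
an optimal action whenever the scaled divergence to a deterministic optimal policy is at
most `𝔇`. -/
structure DivergenceCondition (M : MDP S A) (W : DistGen A) (μ : ℝ) (τ : ℝ → ℝ) : Prop where
  mu_pos : 0 < μ
  strong : ∀ x ∈ stdSimplex ℝ A, ∀ y ∈ simplexInterior A,
    μ / 2 * (∑ a, |x a - y a|) ^ 2 ≤ W.bregman x y
  interior_step : ∀ y ∈ simplexInterior A, ∀ η : ℝ, 0 ≤ η → ∀ q : A → ℝ,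
    ∃ x ∈ simplexInterior A, W.IsProxStep η q y x
  tau_pos : ∀ 𝔇 : ℝ, 0 < 𝔇 → 0 < τ 𝔇
  tau_le : ∀ 𝔇 : ℝ, 0 < 𝔇 → ∀ (s : S) (π πs : Policy S A) (a : A),
    π.IsInterior → M.IsOptimal πs → πs.IsDeterministic → (πs s).1 a = 1 →
    (1 - M.γ) * W.bregman (πs s).1 (π s).1 ≤ 𝔇 → τ 𝔇 ≤ (π s).1 a

end Bregman

section Estimator

variable {S A : Type*}

open Classical in
/-- First time before `n` at which the trajectory `x` visits `z`, and `n` if there is none. -/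
def firstVisit (n : ℕ) (x : ℕ → S × A) (z : S × A) : ℕ :=
  if h : ∃ t, t < n ∧ x t = z then Nat.find h else n

variable [Fintype S] [Fintype A]

/-- On-policy Monte Carlo estimate of the Q-function at `z` from one trajectory of length `n`:
the discounted cost collected from the first visit of `z` on (zero without a visit). -/
def MDP.omc (M : MDP S A) (n : ℕ) (x : ℕ → S × A) (z : S × A) : ℝ :=
  ∑ t ∈ Finset.Ico (firstVisit n x z) n,
    M.γ ^ (t - firstVisit n x z) * M.cost (x t).1 (x t).2

open Classical in
/-- Truncated on-policy Monte Carlo with a single trajectory of length `n` and threshold `θ`. -/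
def MDP.tomc (M : MDP S A) (n : ℕ) (θ : ℝ) (π : Policy S A) (x : ℕ → S × A) (s : S) (a : A) :
    ℝ :=
  if θ ≤ (π s).1 a then M.omc n x (s, a) else 1 / (1 - M.γ)

/-- A run of `k` iterations of stochastic policy mirror descent with constant stepsize `η`,
started at `π₀`, with single-trajectory TOMC of length `n` and threshold `θ`, on the probability
space `(Ω, ℙ)`. `Z t j` is the state-action pair at time `j < n` of the trajectory of iteration
`t < k`, and `π t` is the policy of iteration `t`. The initial pair `Z t 0` is arbitrary (possibly
random and dependent on the past); afterwards, conditionally on all previous trajectories and on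
the current one up to time `j`, the next pair `(s', a')` has probability
`trans(s' | Z t j) * π t (a' | s')`. -/
structure IsRun (M : MDP S A) (W : DistGen A) (η θ : ℝ) (n k : ℕ) (π₀ : Policy S A)
    {Ω : Type*} [MeasurableSpace Ω] (ℙ : Measure Ω)
    (Z : ℕ → ℕ → Ω → S × A) (π : ℕ → Ω → Policy S A) : Prop where
  init : ∀ ω, π 0 ω = π₀
  update : ∀ t < k, ∀ ω s, W.IsProxStep η
    (M.tomc n θ (π t ω) (fun j => Z t j ω) s) (π t ω s).1 (π (t + 1) ω s).1
  measurable : ∀ t < k, ∀ j < n, ∀ z, MeasurableSet {ω | Z t j ω = z}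
  markov : ∀ t < k, ∀ j, j + 1 < n → ∀ (ω₀ : Ω) (z : S × A),
    ℙ {ω | (∀ i < t, ∀ l < n, Z i l ω = Z i l ω₀) ∧ (∀ l ≤ j, Z t l ω = Z t l ω₀) ∧
        Z t (j + 1) ω = z} =
      ℙ {ω | (∀ i < t, ∀ l < n, Z i l ω = Z i l ω₀) ∧ (∀ l ≤ j, Z t l ω = Z t l ω₀)} *
        ENNReal.ofReal (M.trans (Z t j ω₀).1 (Z t j ω₀).2 z.1 * (π t ω₀ z.1).1 z.2)

variable [DecidableEq S]

/-- Almost surely, all policies that generate the trajectories of the `k` iterations mix with the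
common constants `(C, ρ)` and have stationary probabilities at least `νmin`. -/
def UniformMixing (M : MDP S A) (C ρ νmin : ℝ) (k : ℕ)
    {Ω : Type*} [MeasurableSpace Ω] (ℙ : Measure Ω) (π : ℕ → Ω → Policy S A) : Prop :=
  ∀ᵐ ω ∂ℙ, ∀ t < k, M.MixesWith (π t ω) C ρ νmin

/-- With probability at least `1 - δ`, simultaneously for all initial distributions `ϑ`, the
best of the first `k` iterates has optimality gap at most `b`. -/
def GapWithProb (M : MDP S A) (k : ℕ) (δ b : ℝ)
    {Ω : Type*} [MeasurableSpace Ω] (ℙ : Measure Ω) (π : ℕ → Ω → Policy S A) : Prop :=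
  ENNReal.ofReal (1 - δ) ≤
    ℙ {ω | ∀ ϑ ∈ stdSimplex ℝ S, ∀ πs : Policy S A, M.IsOptimal πs →
      (⨅ t : Fin k, M.objective ϑ (π t ω)) - M.objective ϑ πs ≤ b}

end Estimator

section Parameters

variable {S A : Type*} [Fintype S] [Fintype A]

/-- `Z = 4 √(log (|S| k / δ)) / (1 - γ)`. -/
def MDP.Zpar (M : MDP S A) (k : ℕ) (δ : ℝ) : ℝ :=
  4 * √(Real.log (Fintype.card S * k / δ)) / (1 - M.γ)

/-- `ε = 2 / (1 - γ) * √(log (|S| k / δ) / k)`. -/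
def MDP.epsPar (M : MDP S A) (k : ℕ) (δ : ℝ) : ℝ :=
  2 / (1 - M.γ) * √(Real.log (Fintype.card S * k / δ) / k)

/-- `ζ* = min { √(2 D μ / ((2 + Z) M²)), D / (2 + Z) }` with `M = 1 / (1 - γ)`. -/
def MDP.zeta (M : MDP S A) (μ D Z : ℝ) : ℝ :=
  min √(2 * D * μ / ((2 + Z) * (1 / (1 - M.γ)) ^ 2)) (D / (2 + Z))

/-- The threshold `min { τ(D), 1 / |A| }`. -/
def threshold (A : Type*) [Fintype A] (τ : ℝ → ℝ) (D : ℝ) : ℝ :=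
  min (τ D) (1 / Fintype.card A)

/-- `1 / (1 - γ) + max { 1, ⌈log_ρ (νmin θ / (2 C))⌉ } / (νmin θ)`. -/
def MDP.horizon (M : MDP S A) (C ρ νmin θ : ℝ) : ℝ :=
  1 / (1 - M.γ) + (max 1 ⌈Real.logb ρ (νmin * θ / (2 * C))⌉₊ : ℕ) / (νmin * θ)

/-- The order of the trajectory length: `H * log (2 + H |A| / ε)` for the horizon `H`. -/
def MDP.lengthOrder (M : MDP S A) (C ρ νmin θ ε : ℝ) : ℝ :=
  M.horizon C ρ νmin θ * Real.log (2 + M.horizon C ρ νmin θ * Fintype.card A / ε)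

/-- The bound on the optimality gap after `k` iterations. -/
def MDP.gapBound (M : MDP S A) (μ D Z : ℝ) (k : ℕ) : ℝ :=
  D / ((2 + Z) * M.zeta μ D Z * (1 - M.γ) * √k)
    + M.zeta μ D Z * (1 / (1 - M.γ)) ^ 2 / (2 * μ * (1 - M.γ) * √k)
    + Z / ((1 - M.γ) * √k)

/-- The part of the iteration complexity constant that does not come from the noise. -/
def MDP.detConst (M : MDP S A) (μ D Z : ℝ) : ℝ :=
  (1 / (1 - M.γ)) ^ 4 * M.zeta μ D Z ^ 2 / (4 * μ ^ 2 * (1 - M.γ) ^ 2)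
    + D ^ 2 / ((2 + Z) ^ 2 * M.zeta μ D Z ^ 2 * (1 - M.γ) ^ 2)

/-- The constant multiplying `1 / ε²` in the iteration complexity. -/
def MDP.iterConst (M : MDP S A) (μ D Z : ℝ) : ℝ :=
  Z ^ 2 / (1 - M.γ) ^ 2 + M.detConst μ D Z

end Parameters

end SPMD

end

open MeasureTheory

noncomputable section

namespace SPMD

set_option linter.unusedSectionVars false

/-! ### Simplex points concentrated on one action -/

section Simplex

variable {A : Type*} [Fintype A]

/-! Fix a deterministic optimal policy `πs`, choosing the action `f s` in state `s`; one exists as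
soon as any optimal policy does. For each start state the performance difference identity
(`MDP.value_sub_value`) writes the value gap as an average, over the discounted occupancy of `πs`,
of inner products of `Q` with `π_t - πs`. The mirror descent inequality with the estimate in place
of `Q` makes the weighted divergence to `πs` telescope (`IsRun.potential_le`): the summed gaps are
controlled by the initial divergence, the quadratic stepsize terms and the accumulated noise, i.e.
the inner products of `Q` minus its estimate with `π_t - πs`.

The noise needs only a one-sided bound. Against `π_t`, truncated actions are harmless because their
estimate `1 / (1 - γ)` dominates `Q`, and the other actions are hit early with high probability by
mixing (`MDP.bias_mem`). Against `πs`, only the actions `f s` count; if they are not truncated, the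
favourable sign comes from the Monte Carlo estimate never exceeding `Q` in expectation. Hence the
conditional mean of the noise is at most `ε / 2` (`MDP.pathExp_noise_le`), and a Chernoff bound with
a union bound over start states and times keeps all partial sums below `Z √k`
(`IsRun.measure_noise_gt_le`).

That `π_t` gives `f s` probability at least the threshold is not an assumption; it is bootstrapped
(`IsRun.regret_le`). As long as it held in the past, the potential is at most `D` by the choice of
`ζ*`, and condition (3) on the divergence then yields it at the next time. To avoid conditioning on
this event, the noise is set to zero at policies that violate it or do not mix, so the concentration
bound holds unconditionally.

For the complexity statement, `Z` contains `log k`, so the required number of iterations depends on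
itself. With `D = (2 + Z) D₀` everything else is independent of `k`, and the least admissible `k`
has the right order (`exists_iteration_count`). -/

lemma eq_zero_of_apply_eq_one {p : A → ℝ} (hp : p ∈ stdSimplex ℝ A) {a : A} (ha : p a = 1)
    {b : A} (hb : b ≠ a) : p b = 0 := by
  classical
  have h := hp.2
  rw [← Finset.add_sum_erase _ _ (Finset.mem_univ a), ha] at h
  have h0 : ∑ x ∈ Finset.univ.erase a, p x = 0 := by linarith
  exact (Finset.sum_eq_zero_iff_of_nonneg (fun x _ => hp.1 x)).1 h0 b
    (Finset.mem_erase.2 ⟨hb, Finset.mem_univ b⟩)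

lemma sum_mul_of_apply_eq_one {p : A → ℝ} (hp : p ∈ stdSimplex ℝ A) {a : A} (ha : p a = 1)
    (q : A → ℝ) : ∑ b, p b * q b = q a := by
  classical
  rw [Finset.sum_eq_single a (fun b _ hb => by rw [eq_zero_of_apply_eq_one hp ha hb, zero_mul])
    (fun h => absurd (Finset.mem_univ a) h), ha, one_mul]

end Simplex

/-! ### Discounted occupancy, Bellman equations and performance difference -/

section MDPTheory

variable {S A : Type*} [Fintype S] [DecidableEq S] [Fintype A]

lemma MDP.one_sub_γ_pos (M : MDP S A) : 0 < 1 - M.γ := sub_pos.2 M.γ_lt_one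

lemma MDP.stateTrans_nonneg (M : MDP S A) (π : Policy S A) (s s' : S) :
    0 ≤ M.stateTrans π s s' :=
  Finset.sum_nonneg fun a _ => mul_nonneg ((π s).2.1 a) (M.trans_nonneg s a s')

lemma MDP.stateTrans_sum (M : MDP S A) (π : Policy S A) (s : S) :
    ∑ s', M.stateTrans π s s' = 1 := by
  simp only [MDP.stateTrans, Matrix.of_apply]
  rw [Finset.sum_comm]
  simp only [← Finset.mul_sum, M.trans_sum, mul_one]
  exact (π s).2.2

lemma MDP.stateTrans_pow_nonneg (M : MDP S A) (π : Policy S A) (t : ℕ) (s s' : S) :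
    0 ≤ (M.stateTrans π ^ t) s s' := by
  induction t generalizing s' with
  | zero =>
    rw [pow_zero, Matrix.one_apply]
    split_ifs <;> norm_num
  | succ t ih =>
    rw [pow_succ, Matrix.mul_apply]
    exact Finset.sum_nonneg fun u _ => mul_nonneg (ih u) (M.stateTrans_nonneg π u s')

lemma MDP.stateTrans_pow_sum (M : MDP S A) (π : Policy S A) (t : ℕ) (s : S) :
    ∑ s', (M.stateTrans π ^ t) s s' = 1 := by
  induction t with
  | zero => simp [Matrix.one_apply]
  | succ t ih =>
    simp only [pow_succ, Matrix.mul_apply]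
    rw [Finset.sum_comm]
    simp only [← Finset.mul_sum, M.stateTrans_sum, mul_one, ih]

lemma MDP.stateTrans_pow_le_one (M : MDP S A) (π : Policy S A) (t : ℕ) (s s' : S) :
    (M.stateTrans π ^ t) s s' ≤ 1 := by
  rw [← M.stateTrans_pow_sum π t s]
  exact Finset.single_le_sum (f := fun s' => (M.stateTrans π ^ t) s s')
    (fun u _ => M.stateTrans_pow_nonneg π t s u) (Finset.mem_univ s')

lemma MDP.summable_occupancy (M : MDP S A) (π : Policy S A) (s s' : S) :
    Summable fun t : ℕ => M.γ ^ t * (M.stateTrans π ^ t) s s' :=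
  Summable.of_nonneg_of_le
    (fun t => mul_nonneg (pow_nonneg M.γ_pos.le t) (M.stateTrans_pow_nonneg π t s s'))
    (fun t => mul_le_of_le_one_right (pow_nonneg M.γ_pos.le t) (M.stateTrans_pow_le_one π t s s'))
    (summable_geometric_of_lt_one M.γ_pos.le M.γ_lt_one)

/-- The unnormalized discounted occupancy measure. -/
def MDP.occupancy (M : MDP S A) (π : Policy S A) : Matrix S S ℝ :=
  Matrix.of fun s s' => ∑' t : ℕ, M.γ ^ t * (M.stateTrans π ^ t) s s'

lemma MDP.occupancy_nonneg (M : MDP S A) (π : Policy S A) (s s' : S) :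
    0 ≤ M.occupancy π s s' :=
  tsum_nonneg fun t => mul_nonneg (pow_nonneg M.γ_pos.le t) (M.stateTrans_pow_nonneg π t s s')

lemma MDP.occupancy_apply (M : MDP S A) (π : Policy S A) (s s' : S) :
    M.occupancy π s s' =
      (1 : Matrix S S ℝ) s s' + M.γ * ∑ u, M.occupancy π s u * M.stateTrans π u s' := by
  have h : ∀ u, M.occupancy π s u * M.stateTrans π u s' =
      ∑' t : ℕ, M.γ ^ t * (M.stateTrans π ^ t) s u * M.stateTrans π u s' := fun u => by
    rw [tsum_mul_right]; rfl
  simp only [h]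
  rw [← Summable.tsum_finsetSum (fun u _ => (M.summable_occupancy π s u).mul_right _),
    ← tsum_mul_left]
  conv_lhs => rw [MDP.occupancy, Matrix.of_apply,
    (M.summable_occupancy π s s').tsum_eq_zero_add]
  simp only [pow_zero, one_mul]
  congr 1
  refine tsum_congr fun t => ?_
  rw [pow_succ, pow_succ (M.stateTrans π), Matrix.mul_apply, mul_comm (M.γ ^ t), mul_assoc,
    Finset.mul_sum]
  simp only [mul_assoc]

/-- The Neumann series: the occupancy matrix inverts `1 - γ P`. Used from this side it gives
telescoping along the chain; from the other side, the Bellman equation. -/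
lemma MDP.occupancy_mul (M : MDP S A) (π : Policy S A) :
    M.occupancy π * (1 - M.γ • M.stateTrans π) = 1 := by
  rw [mul_sub, mul_one, Matrix.mul_smul]
  ext s s'
  rw [Matrix.sub_apply, Matrix.smul_apply, Matrix.mul_apply, smul_eq_mul, M.occupancy_apply π s s']
  ring

/-- Discounted summation of `f - γ P f` along the chain recovers `f`. -/
lemma MDP.occupancy_telescope (M : MDP S A) (π : Policy S A) (f : S → ℝ) (s : S) :
    ∑ s', M.occupancy π s s' * (f s' - M.γ * ∑ u, M.stateTrans π s' u * f u) = f s := by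
  have h := congrFun (congrArg (fun X : Matrix S S ℝ => X.mulVec f) (M.occupancy_mul π)) s
  simp only [← Matrix.mulVec_mulVec, Matrix.one_mulVec, Matrix.sub_mulVec, Matrix.smul_mulVec] at h
  simpa [Matrix.mulVec, dotProduct] using h

lemma MDP.occupancy_sum (M : MDP S A) (π : Policy S A) (s : S) :
    (1 - M.γ) * ∑ s', M.occupancy π s s' = 1 := by
  have h := M.occupancy_telescope π (fun _ => 1) s
  simp only [mul_one, M.stateTrans_sum, ← Finset.sum_mul] at h
  linarith

lemma MDP.one_le_occupancy_self (M : MDP S A) (π : Policy S A) (s : S) :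
    1 ≤ M.occupancy π s s := by
  rw [M.occupancy_apply, Matrix.one_apply_eq]
  have : 0 ≤ M.γ * ∑ u, M.occupancy π s u * M.stateTrans π u s :=
    mul_nonneg M.γ_pos.le (Finset.sum_nonneg fun u _ =>
      mul_nonneg (M.occupancy_nonneg π s u) (M.stateTrans_nonneg π u s))
  linarith

/-- The expected one-step cost of a policy. -/
def MDP.stepCost (M : MDP S A) (π : Policy S A) (s : S) : ℝ := ∑ a, (π s).1 a * M.cost s a

lemma MDP.value_eq_occupancy (M : MDP S A) (π : Policy S A) (s : S) :
    M.value π s = ∑ s', M.occupancy π s s' * M.stepCost π s' := by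
  have h : ∀ s', M.occupancy π s s' * M.stepCost π s' =
      ∑' t : ℕ, M.γ ^ t * (M.stateTrans π ^ t) s s' * M.stepCost π s' := fun u => by
    rw [tsum_mul_right]; rfl
  simp only [h]
  rw [← Summable.tsum_finsetSum (fun u _ => (M.summable_occupancy π s u).mul_right _)]
  refine tsum_congr fun t => ?_
  rw [Finset.mul_sum]
  simp only [mul_assoc]
  rfl

lemma MDP.value_eq_stepCost_add (M : MDP S A) (π : Policy S A) (s : S) :
    M.value π s = M.stepCost π s + M.γ * ∑ s', M.stateTrans π s s' * M.value π s' := by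
  -- A one-sided inverse of a finite square matrix is two-sided.
  have h1 := mul_eq_one_comm.1 (M.occupancy_mul π)
  have hv : M.value π = (M.occupancy π).mulVec (M.stepCost π) := by
    ext s; exact M.value_eq_occupancy π s
  have h := congrFun (congrArg (fun X : Matrix S S ℝ => X.mulVec (M.stepCost π)) h1) s
  simp only [← Matrix.mulVec_mulVec, Matrix.one_mulVec, Matrix.sub_mulVec, Matrix.smul_mulVec,
    ← hv] at h
  simp only [Pi.sub_apply, Pi.smul_apply, smul_eq_mul, Matrix.mulVec, dotProduct] at h
  linarith

lemma MDP.stepCost_nonneg (M : MDP S A) (π : Policy S A) (s : S) : 0 ≤ M.stepCost π s :=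
  Finset.sum_nonneg fun a _ => mul_nonneg ((π s).2.1 a) (M.cost_nonneg s a)

lemma MDP.stepCost_le_one (M : MDP S A) (π : Policy S A) (s : S) : M.stepCost π s ≤ 1 := by
  rw [← (π s).2.2]
  exact Finset.sum_le_sum fun a _ => mul_le_of_le_one_right ((π s).2.1 a) (M.cost_le_one s a)

lemma MDP.value_nonneg (M : MDP S A) (π : Policy S A) (s : S) : 0 ≤ M.value π s := by
  rw [M.value_eq_occupancy]
  exact Finset.sum_nonneg fun u _ => mul_nonneg (M.occupancy_nonneg π s u) (M.stepCost_nonneg π u)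

lemma MDP.value_le (M : MDP S A) (π : Policy S A) (s : S) : M.value π s ≤ 1 / (1 - M.γ) := by
  rw [M.value_eq_occupancy, le_div_iff₀' M.one_sub_γ_pos]
  refine le_trans ?_ (M.occupancy_sum π s).le
  exact mul_le_mul_of_nonneg_left (Finset.sum_le_sum fun u _ =>
    mul_le_of_le_one_right (M.occupancy_nonneg π s u) (M.stepCost_le_one π u)) M.one_sub_γ_pos.le

/-- The action-value function. -/
def MDP.qvalue (M : MDP S A) (π : Policy S A) (z : S × A) : ℝ :=
  M.cost z.1 z.2 + M.γ * ∑ s', M.trans z.1 z.2 s' * M.value π s'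

lemma MDP.sum_mul_qvalue (M : MDP S A) (π π' : Policy S A) (s : S) :
    ∑ a, (π' s).1 a * M.qvalue π (s, a) =
      M.stepCost π' s + M.γ * ∑ s', M.stateTrans π' s s' * M.value π s' := by
  simp only [MDP.qvalue, mul_add, Finset.sum_add_distrib, MDP.stepCost, MDP.stateTrans,
    Matrix.of_apply, Finset.sum_mul, Finset.mul_sum]
  rw [add_right_inj, Finset.sum_comm]
  refine Finset.sum_congr rfl fun s' _ => Finset.sum_congr rfl fun a _ => ?_
  ring

lemma MDP.value_eq_sum_qvalue (M : MDP S A) (π : Policy S A) (s : S) :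
    M.value π s = ∑ a, (π s).1 a * M.qvalue π (s, a) := by
  rw [M.sum_mul_qvalue, ← M.value_eq_stepCost_add]

lemma MDP.qvalue_nonneg (M : MDP S A) (π : Policy S A) (z : S × A) : 0 ≤ M.qvalue π z :=
  add_nonneg (M.cost_nonneg _ _) (mul_nonneg M.γ_pos.le (Finset.sum_nonneg fun s' _ =>
    mul_nonneg (M.trans_nonneg _ _ s') (M.value_nonneg π s')))

lemma MDP.qvalue_le (M : MDP S A) (π : Policy S A) (z : S × A) :
    M.qvalue π z ≤ 1 / (1 - M.γ) := by
  have h1 : ∑ s', M.trans z.1 z.2 s' * M.value π s' ≤ 1 / (1 - M.γ) := by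
    calc _ ≤ ∑ s', M.trans z.1 z.2 s' * (1 / (1 - M.γ)) :=
          Finset.sum_le_sum fun s' _ =>
            mul_le_mul_of_nonneg_left (M.value_le π s') (M.trans_nonneg _ _ s')
      _ = _ := by rw [← Finset.sum_mul, M.trans_sum, one_mul]
  have h2 := M.cost_le_one z.1 z.2
  have h3 := mul_le_mul_of_nonneg_left h1 M.γ_pos.le
  have h4 : 1 + M.γ * (1 / (1 - M.γ)) = 1 / (1 - M.γ) := by
    have := M.one_sub_γ_pos.ne'
    field_simp
    ring
  unfold MDP.qvalue
  linarith

/-- The performance difference identity. -/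
lemma MDP.value_sub_value (M : MDP S A) (π πs : Policy S A) (s : S) :
    M.value π s - M.value πs s = ∑ s', M.occupancy πs s s' *
      ∑ a, ((π s').1 a - (πs s').1 a) * M.qvalue π (s', a) := by
  rw [← M.occupancy_telescope πs (fun s => M.value π s - M.value πs s) s]
  refine Finset.sum_congr rfl fun s' _ => ?_
  congr 1
  simp only [sub_mul, mul_sub, Finset.sum_sub_distrib]
  rw [← M.value_eq_sum_qvalue, M.sum_mul_qvalue]
  have := M.value_eq_stepCost_add πs s'
  linarith

variable [Nonempty A]

/-- The deterministic policy choosing the action `f s` in state `s`. -/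
def purePolicy [DecidableEq A] (f : S → A) : Policy S A :=
  fun s => ⟨Pi.single (f s) 1, single_mem_stdSimplex ℝ (f s)⟩

/-- Greedy improvement of an optimal policy is deterministic and optimal. -/
lemma MDP.exists_deterministic_optimal (M : MDP S A) {π : Policy S A} (hπ : M.IsOptimal π) :
    ∃ (πs : Policy S A) (f : S → A), M.IsOptimal πs ∧ ∀ s, (πs s).1 (f s) = 1 := by
  classical
  have h : ∀ s, ∃ a, ∀ b, M.qvalue π (s, a) ≤ M.qvalue π (s, b) := fun s =>
    Finite.exists_min fun a => M.qvalue π (s, a)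
  choose f hf using h
  have hone : ∀ s, (purePolicy f s).1 (f s) = 1 := fun s => by simp [purePolicy]
  refine ⟨purePolicy f, f, fun π' s => ?_, hone⟩
  refine le_trans ?_ (hπ π' s)
  -- In the performance difference the occupancy is that of the greedy policy and `Q` that of `π`,
  -- so every summand is nonnegative by greediness.
  rw [← sub_nonneg, M.value_sub_value]
  refine Finset.sum_nonneg fun s' _ => mul_nonneg (M.occupancy_nonneg _ _ _) ?_
  simp only [sub_mul, Finset.sum_sub_distrib]
  rw [sum_mul_of_apply_eq_one (purePolicy f s').2 (hone s') fun a => M.qvalue π (s', a),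
    sub_nonneg]
  calc M.qvalue π (s', f s') = ∑ a, (π s').1 a * M.qvalue π (s', f s') := by
        rw [← Finset.sum_mul, (π s').2.2, one_mul]
    _ ≤ _ := Finset.sum_le_sum fun a _ => mul_le_mul_of_nonneg_left (hf s' a) ((π s').2.1 a)

end MDPTheory

/-! ### Mirror descent steps -/

section Mirror

variable {A : Type*} [Fintype A]

/-- The objective is `w` plus an affine function, hence strictly convex. Uniqueness is what makes
each policy a function of the past trajectories. -/
lemma DistGen.prox_unique (W : DistGen A) {η : ℝ} {q y x x' : A → ℝ}
    (hx : W.IsProxStep η q y x) (hx' : W.IsProxStep η q y x') : x = x' := by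
  have hlin : ConvexOn ℝ (stdSimplex ℝ A)
      (fun p : A → ℝ => η * ∑ a, q a * p a - W.w y - W.grad y (p - y)) := by
    refine ⟨convex_stdSimplex ℝ A, fun p _ r _ a b _ _ hab => le_of_eq ?_⟩
    simp only [Pi.add_apply, Pi.smul_apply, smul_eq_mul, mul_add, Finset.sum_add_distrib,
      map_sub, map_add, map_smul, mul_left_comm _ a, mul_left_comm _ b, ← Finset.mul_sum]
    linear_combination (W.w y - W.grad y y) * hab
  have hconv : StrictConvexOn ℝ (stdSimplex ℝ A)
      (fun p : A → ℝ => η * ∑ a, q a * p a + W.bregman p y) := by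
    have h := W.strictConvex.add_convexOn hlin
    have he : (fun p : A → ℝ => η * ∑ a, q a * p a + W.bregman p y) =
        W.w + fun p : A → ℝ => η * ∑ a, q a * p a - W.w y - W.grad y (p - y) := by
      funext p
      simp only [DistGen.bregman, Pi.add_apply]
      ring
    rw [he]
    exact h
  exact hconv.eq_of_isMinOn hx.2 hx'.2 hx.1 hx'.1

/-- The three-point inequality for mirror descent steps. -/
lemma DistGen.three_point (W : DistGen A) {η : ℝ} {q y x p : A → ℝ}
    (hx : W.IsProxStep η q y x) (hxi : x ∈ simplexInterior A) (hp : p ∈ stdSimplex ℝ A) :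
    η * ∑ a, q a * (x a - p a) + W.bregman x y + W.bregman p x ≤ W.bregman p y := by
  let ℓ : (A → ℝ) →L[ℝ] ℝ := ∑ a, q a • ContinuousLinearMap.proj (R := ℝ) (φ := fun _ : A => ℝ) a
  have hℓ : ∀ v, ℓ v = ∑ a, q a * v a := fun v => by simp [ℓ]
  have hd : HasFDerivWithinAt (fun p : A → ℝ => η * ∑ a, q a * p a + W.bregman p y)
      (η • ℓ + (W.grad x - W.grad y)) (stdSimplex ℝ A) x := by
    have h1 : HasFDerivWithinAt (fun p : A → ℝ => η * ∑ a, q a * p a) (η • ℓ)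
        (stdSimplex ℝ A) x := by
      have := (ℓ.hasFDerivWithinAt (s := stdSimplex ℝ A) (x := x)).const_mul η
      simpa only [hℓ] using this
    have h2 : HasFDerivWithinAt (fun p : A → ℝ => W.bregman p y) (W.grad x - W.grad y)
        (stdSimplex ℝ A) x := by
      have h3 : HasFDerivWithinAt (fun p : A → ℝ => W.grad y (p - y)) (W.grad y)
          (stdSimplex ℝ A) x := by
        simp only [map_sub]
        exact ((W.grad y).hasFDerivWithinAt).sub_const _
      exact ((W.hasGrad x hxi).sub_const _).sub h3
    exact h1.add h2
  -- First-order optimality along the segment from `x` to `p`; `w` is only differentiable relative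
  -- to the simplex, so the derivative is tested on tangent directions.
  have hcone : p - x ∈ posTangentConeAt (stdSimplex ℝ A) x :=
    sub_mem_posTangentConeAt_of_segment_subset
      ((convex_stdSimplex ℝ A).segment_subset hx.1 hp)
  have h := (hx.2.localize).hasFDerivWithinAt_nonneg hd hcone
  simp only [add_apply, sub_apply, smul_apply, hℓ, smul_eq_mul, Pi.sub_apply] at h
  have hs : ∑ a, q a * (x a - p a) = - ∑ a, q a * (p a - x a) := by
    rw [← Finset.sum_neg_distrib]
    exact Finset.sum_congr rfl fun a _ => by ring
  rw [hs]
  simp only [DistGen.bregman, map_sub] at h ⊢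
  linarith

lemma mul_sub_sq_le {b μ : ℝ} (hμ : 0 < μ) (u : ℝ) : b * u - μ / 2 * u ^ 2 ≤ b ^ 2 / (2 * μ) := by
  rw [le_div_iff₀ (by positivity)]
  nlinarith [sq_nonneg (b - μ * u)]

variable {S : Type*} [Fintype S] [DecidableEq S]

lemma DivergenceCondition.bregman_nonneg {M : MDP S A} {W : DistGen A} {μ : ℝ} {τ : ℝ → ℝ}
    (h : DivergenceCondition M W μ τ) {x y : A → ℝ} (hx : x ∈ stdSimplex ℝ A)
    (hy : y ∈ simplexInterior A) : 0 ≤ W.bregman x y :=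
  le_trans (mul_nonneg (half_pos h.mu_pos).le (sq_nonneg _)) (h.strong x hx y hy)

/-- Some minimizer is interior by assumption, and the minimizer is unique. -/
lemma DivergenceCondition.prox_interior {M : MDP S A} {W : DistGen A} {μ : ℝ} {τ : ℝ → ℝ}
    (h : DivergenceCondition M W μ τ) {η : ℝ} (hη : 0 ≤ η) {q x y : A → ℝ}
    (hy : y ∈ simplexInterior A) (hx : W.IsProxStep η q y x) : x ∈ simplexInterior A := by
  obtain ⟨x', hx', hp⟩ := h.interior_step y hy η hη q
  rwa [W.prox_unique hx hp]

/-- One mirror descent step with a gradient bounded by `G`. -/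
lemma DivergenceCondition.step_le {M : MDP S A} {W : DistGen A} {μ : ℝ} {τ : ℝ → ℝ}
    (h : DivergenceCondition M W μ τ) {η : ℝ} (hη : 0 ≤ η) {q x y p : A → ℝ} {G : ℝ}
    (hq : ∀ a, |q a| ≤ G) (hy : y ∈ simplexInterior A) (hx : W.IsProxStep η q y x)
    (hp : p ∈ stdSimplex ℝ A) :
    η * ∑ a, q a * (y a - p a) + W.bregman p x ≤ W.bregman p y + (η * G) ^ 2 / (2 * μ) := by
  have h3 := W.three_point hx (h.prox_interior hη hy hx) hp
  have hs := h.strong x hx.1 y hy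
  -- The `x - p` part is handled by the three-point inequality; the `y - x` part is paid for by
  -- strong convexity through Young's inequality.
  have hsum : ∑ a, q a * (y a - p a) = ∑ a, q a * (x a - p a) + ∑ a, q a * (y a - x a) := by
    rw [← Finset.sum_add_distrib]
    exact Finset.sum_congr rfl fun a _ => by ring
  have hG : ∑ a, q a * (y a - x a) ≤ G * ∑ a, |x a - y a| := by
    rw [Finset.mul_sum]
    refine Finset.sum_le_sum fun a _ => ?_
    calc q a * (y a - x a) ≤ |q a * (y a - x a)| := le_abs_self _
      _ = |q a| * |x a - y a| := by rw [abs_mul, abs_sub_comm]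
      _ ≤ _ := mul_le_mul_of_nonneg_right (hq a) (abs_nonneg _)
  have hsq := mul_sub_sq_le (b := η * G) h.mu_pos (∑ a, |x a - y a|)
  have := mul_le_mul_of_nonneg_left hG hη
  rw [hsum, mul_add]
  linarith

end Mirror

/-! ### Path expectations of finite Markov chains, Hoeffding's lemma, hitting times -/

section PathExpectation

variable {X : Type*} [Fintype X]

/-- The expectation of `g` along a Markov chain with kernel `K`, when the path is known to follow
`x` up to time `j` and takes `m` further steps. -/
def pathExp (K : X → X → ℝ) (g : (ℕ → X) → ℝ) : ℕ → ℕ → (ℕ → X) → ℝ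
  | 0, _, x => g x
  | m + 1, j, x => ∑ z, K (x j) z * pathExp K g m (j + 1) (Function.update x (j + 1) z)

/-- Stochastic kernels on a finite type. -/
structure IsStochastic (K : X → X → ℝ) : Prop where
  nonneg : ∀ z z', 0 ≤ K z z'
  sum_eq_one : ∀ z, ∑ z', K z z' = 1

lemma agree_of_agree_update {Y : Type*} {x y : ℕ → Y} {j : ℕ} {z : Y}
    (h : ∀ l ≤ j + 1, y l = Function.update x (j + 1) z l) : ∀ l ≤ j, y l = x l := fun l hl => by
  rw [h l (by omega), Function.update_of_ne (by omega)]

lemma IsStochastic.sum_mul_le {K : X → X → ℝ} (hK : IsStochastic K) {f : X → ℝ} {b : ℝ}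
    (h : ∀ z, f z ≤ b) (z : X) : ∑ z', K z z' * f z' ≤ b := by
  calc _ ≤ ∑ z', K z z' * b :=
        Finset.sum_le_sum fun z' _ => mul_le_mul_of_nonneg_left (h z') (hK.nonneg z z')
    _ = b := by rw [← Finset.sum_mul, hK.sum_eq_one, one_mul]

lemma IsStochastic.sum_mul_nonneg {K : X → X → ℝ} (hK : IsStochastic K) {f : X → ℝ}
    (h : ∀ z, 0 ≤ f z) (z : X) : 0 ≤ ∑ z', K z z' * f z' :=
  Finset.sum_nonneg fun z' _ => mul_nonneg (hK.nonneg z z') (h z')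

/-- Only paths that extend the known prefix contribute, so the comparison is needed only on those.
-/
lemma pathExp_mono {K : X → X → ℝ} (hK : IsStochastic K) {g g' : (ℕ → X) → ℝ} (m : ℕ) :
    ∀ (j : ℕ) (x : ℕ → X), (∀ y, (∀ l ≤ j, y l = x l) → g y ≤ g' y) →
      pathExp K g m j x ≤ pathExp K g' m j x := by
  induction m with
  | zero => exact fun j x h => h x fun _ _ => rfl
  | succ m ih =>
    intro j x h
    exact Finset.sum_le_sum fun z _ => mul_le_mul_of_nonneg_left
      (ih _ _ fun y hy => h y (agree_of_agree_update hy)) (hK.nonneg _ _)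

lemma pathExp_congr {K : X → X → ℝ} (hK : IsStochastic K) {g g' : (ℕ → X) → ℝ} (m : ℕ)
    (j : ℕ) (x : ℕ → X) (h : ∀ y, (∀ l ≤ j, y l = x l) → g y = g' y) :
    pathExp K g m j x = pathExp K g' m j x :=
  le_antisymm (pathExp_mono hK m j x fun y hy => (h y hy).le)
    (pathExp_mono hK m j x fun y hy => (h y hy).ge)

lemma pathExp_const {K : X → X → ℝ} (hK : IsStochastic K) (c : ℝ) (m : ℕ) :
    ∀ (j : ℕ) (x : ℕ → X), pathExp K (fun _ => c) m j x = c := by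
  induction m with
  | zero => exact fun _ _ => rfl
  | succ m ih =>
    intro j x
    simp only [pathExp, ih, ← Finset.sum_mul, hK.sum_eq_one, one_mul]

lemma pathExp_add (K : X → X → ℝ) (g g' : (ℕ → X) → ℝ) (m : ℕ) :
    ∀ (j : ℕ) (x : ℕ → X), pathExp K (fun y => g y + g' y) m j x =
      pathExp K g m j x + pathExp K g' m j x := by
  induction m with
  | zero => exact fun _ _ => rfl
  | succ m ih =>
    intro j x
    simp only [pathExp, ih, mul_add, Finset.sum_add_distrib]

lemma pathExp_const_mul (K : X → X → ℝ) (c : ℝ) (g : (ℕ → X) → ℝ) (m : ℕ) :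
    ∀ (j : ℕ) (x : ℕ → X), pathExp K (fun y => c * g y) m j x = c * pathExp K g m j x := by
  induction m with
  | zero => exact fun _ _ => rfl
  | succ m ih =>
    intro j x
    simp only [pathExp, ih, Finset.mul_sum, mul_left_comm c]

lemma pathExp_sum {ι : Type*} (K : X → X → ℝ) (s : Finset ι) (g : ι → (ℕ → X) → ℝ) (m : ℕ)
    (j : ℕ) (x : ℕ → X) : pathExp K (fun y => ∑ i ∈ s, g i y) m j x =
      ∑ i ∈ s, pathExp K (g i) m j x := by
  classical
  induction s using Finset.induction_on with
  | empty =>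
    have := pathExp_const_mul K 0 (fun _ => 0) m j x
    simpa using this
  | insert i s hi ih => simp only [Finset.sum_insert hi, pathExp_add, ih]

lemma pathExp_le {K : X → X → ℝ} (hK : IsStochastic K) {g : (ℕ → X) → ℝ} {b : ℝ}
    (h : ∀ y, g y ≤ b) (m j : ℕ) (x : ℕ → X) : pathExp K g m j x ≤ b :=
  (pathExp_mono hK m j x fun y _ => h y).trans_eq (pathExp_const hK b m j x)

lemma le_pathExp {K : X → X → ℝ} (hK : IsStochastic K) {g : (ℕ → X) → ℝ} {b : ℝ}
    (h : ∀ y, b ≤ g y) (m j : ℕ) (x : ℕ → X) : b ≤ pathExp K g m j x :=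
  (pathExp_const hK b m j x).symm.trans_le (pathExp_mono hK m j x fun y _ => h y)

/-- The chord of the exponential function over `[-b, b]`. -/
lemma exp_le_cosh_add {b u : ℝ} (hb : 0 < b) (hu : |u| ≤ b) :
    Real.exp u ≤ Real.cosh b + u * (Real.sinh b / b) := by
  obtain ⟨h1, h2⟩ := abs_le.1 hu
  have h0 : 0 ≤ (b - u) / (2 * b) := div_nonneg (by linarith) (by linarith)
  have h0' : 0 ≤ (b + u) / (2 * b) := div_nonneg (by linarith) (by linarith)
  have h := convexOn_exp.2 (Set.mem_univ (-b)) (Set.mem_univ b) h0 h0' (by field_simp; ring)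
  simp only [smul_eq_mul] at h
  have e1 : (b - u) / (2 * b) * -b + (b + u) / (2 * b) * b = u := by field_simp; ring
  rw [e1] at h
  refine h.trans_eq ?_
  rw [Real.cosh_eq, Real.sinh_eq]
  field_simp
  ring

/-- Hoeffding's lemma for path expectations. -/
lemma pathExp_exp_le {K : X → X → ℝ} (hK : IsStochastic K) {g : (ℕ → X) → ℝ} {G β lam c₀ : ℝ}
    (hG : 0 < G) (hlam : 0 < lam) (m j : ℕ) (x : ℕ → X) (hg : ∀ y, |g y - c₀| ≤ G)
    (hβ : pathExp K g m j x ≤ β) :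
    pathExp K (fun y => Real.exp (lam * g y)) m j x ≤
      Real.exp (lam * β + 2 * lam ^ 2 * G ^ 2) := by
  set e := pathExp K g m j x with he
  -- Values within `G` of `c₀` lie within `2 * G` of their own mean; this is the source of the
  -- constant `2 * lam ^ 2 * G ^ 2`.
  have hb : 0 < lam * (2 * G) := by positivity
  have he0 : |e - c₀| ≤ G := by
    rw [abs_le]
    constructor
    · have := le_pathExp hK (g := g) (b := c₀ - G) (fun y => by linarith [(abs_le.1 (hg y)).1]) m j x
      linarith
    · have := pathExp_le hK (g := g) (b := c₀ + G) (fun y => by linarith [(abs_le.1 (hg y)).2]) m j x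
      linarith
  have hdev : ∀ y, |lam * (g y - e)| ≤ lam * (2 * G) := fun y => by
    rw [abs_mul, abs_of_pos hlam]
    refine mul_le_mul_of_nonneg_left ?_ hlam.le
    have h1 := abs_le.1 (hg y)
    have h2 := abs_le.1 he0
    rw [abs_le]
    constructor <;> linarith [h1.1, h1.2, h2.1, h2.2]
  set r := Real.sinh (lam * (2 * G)) / (lam * (2 * G))
  -- The chord bound is affine in `g y`, so its path expectation involves only the mean `e`.
  have h1 : ∀ y, Real.exp (lam * g y) ≤ Real.exp (lam * e) *
      (lam * r * g y + (Real.cosh (lam * (2 * G)) - lam * r * e)) := fun y => by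
    have h2 := exp_le_cosh_add hb (hdev y)
    calc Real.exp (lam * g y) = Real.exp (lam * e) * Real.exp (lam * (g y - e)) := by
          rw [← Real.exp_add]; congr 1; ring
      _ ≤ _ := mul_le_mul_of_nonneg_left (h2.trans_eq (by ring)) (Real.exp_pos _).le
  refine (pathExp_mono hK m j x fun y _ => h1 y).trans ?_
  rw [pathExp_const_mul, pathExp_add, pathExp_const_mul, pathExp_const hK, ← he]
  have h3 : lam * r * e + (Real.cosh (lam * (2 * G)) - lam * r * e) ≤
      Real.exp (2 * lam ^ 2 * G ^ 2) := by
    have := Real.cosh_le_exp_half_sq (lam * (2 * G))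
    rw [show (lam * (2 * G)) ^ 2 / 2 = 2 * lam ^ 2 * G ^ 2 by ring] at this
    linarith
  rw [Real.exp_add]
  exact mul_le_mul (Real.exp_le_exp.2 (mul_le_mul_of_nonneg_left hβ hlam.le)) h3
    (by have := Real.cosh_pos (lam * (2 * G)); linarith) (Real.exp_pos _).le

/-- The discounted cost collected from time `j` on, up to time `n`. -/
def discountedSum (γ : ℝ) (c : X → ℝ) (n j : ℕ) (y : ℕ → X) : ℝ :=
  ∑ t ∈ Finset.Ico j n, γ ^ (t - j) * c (y t)

lemma discountedSum_eq_add {γ : ℝ} {c : X → ℝ} {n j : ℕ} (h : j < n) (y : ℕ → X) :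
    discountedSum γ c n j y = c (y j) + γ * discountedSum γ c n (j + 1) y := by
  rw [discountedSum, Finset.sum_eq_sum_Ico_succ_bot h, Nat.sub_self, pow_zero, one_mul,
    discountedSum, Finset.mul_sum]
  congr 1
  refine Finset.sum_congr rfl fun t ht => ?_
  have := Finset.mem_Ico.1 ht
  rw [show t - j = t - (j + 1) + 1 by omega, pow_succ]
  ring

lemma discountedSum_self (γ : ℝ) (c : X → ℝ) (n : ℕ) (y : ℕ → X) :
    discountedSum γ c n n y = 0 := by
  simp [discountedSum]

lemma discountedSum_mem {γ : ℝ} (h0 : 0 < γ) (h1 : γ < 1) {c : X → ℝ} (hc0 : ∀ z, 0 ≤ c z)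
    (hc1 : ∀ z, c z ≤ 1) (n j : ℕ) (y : ℕ → X) :
    discountedSum γ c n j y ∈ Set.Icc 0 (1 / (1 - γ)) := by
  constructor
  · exact Finset.sum_nonneg fun t _ => mul_nonneg (pow_nonneg h0.le _) (hc0 _)
  · calc discountedSum γ c n j y ≤ ∑ t ∈ Finset.Ico j n, γ ^ (t - j) :=
          Finset.sum_le_sum fun t _ => mul_le_of_le_one_right (pow_nonneg h0.le _) (hc1 _)
      _ = ∑ i ∈ Finset.range (n - j), γ ^ i := by
          rw [Finset.sum_Ico_eq_sum_range]
          exact Finset.sum_congr rfl fun i _ => by rw [Nat.add_sub_cancel_left]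
      _ ≤ ∑' i : ℕ, γ ^ i := (summable_geometric_of_lt_one h0.le h1).sum_le_tsum _
          fun i _ => pow_nonneg h0.le i
      _ = 1 / (1 - γ) := by rw [tsum_geometric_of_lt_one h0.le h1, one_div]

variable {K : X → X → ℝ} {γ G : ℝ} {c Q : X → ℝ}

/-- Truncating the discounted cost after `m + 1` steps costs at most `γ ^ (m + 1) * G`. -/
lemma pathExp_discountedSum_mem (hK : IsStochastic K) (h0 : 0 ≤ γ)
    (hQ : ∀ z, Q z = c z + γ * ∑ z', K z z' * Q z') (hQ0 : ∀ z, 0 ≤ Q z) (hQG : ∀ z, Q z ≤ G)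
    {n : ℕ} (m : ℕ) : ∀ (j : ℕ) (x : ℕ → X), n = j + m + 1 →
      pathExp K (discountedSum γ c n j) m j x ∈ Set.Icc (Q (x j) - γ ^ (m + 1) * G) (Q (x j)) := by
  induction m with
  | zero =>
    intro j x hn
    have hx : pathExp K (discountedSum γ c n j) 0 j x = c (x j) := by
      rw [pathExp, discountedSum_eq_add (by omega), show j + 1 = n by omega, discountedSum_self,
        mul_zero, add_zero]
    rw [hx, hQ (x j)]
    have h1 := mul_le_mul_of_nonneg_left (hK.sum_mul_le hQG (x j)) h0
    have h2 := mul_nonneg h0 (hK.sum_mul_nonneg hQ0 (x j))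
    rw [zero_add, pow_one]
    constructor <;> linarith
  | succ m ih =>
    intro j x hn
    -- The estimate obeys the same one-step recursion as `Q`, so the truncation error is multiplied
    -- by `γ` at each step.
    have hx : pathExp K (discountedSum γ c n j) (m + 1) j x = c (x j) + γ * ∑ z, K (x j) z *
        pathExp K (discountedSum γ c n (j + 1)) m (j + 1) (Function.update x (j + 1) z) := by
      have h1 : ∀ z, pathExp K (discountedSum γ c n j) m (j + 1) (Function.update x (j + 1) z) =
          γ * pathExp K (discountedSum γ c n (j + 1)) m (j + 1) (Function.update x (j + 1) z) +
            c (x j) := fun z => by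
        rw [← pathExp_const_mul, ← pathExp_const hK (c (x j)) m (j + 1)
          (Function.update x (j + 1) z), ← pathExp_add]
        refine pathExp_congr hK _ _ _ fun y hy => ?_
        rw [discountedSum_eq_add (by omega), agree_of_agree_update hy j le_rfl, add_comm]
      rw [pathExp]
      simp only [h1, mul_add, Finset.sum_add_distrib, ← Finset.sum_mul, hK.sum_eq_one, one_mul,
        mul_left_comm _ γ, ← Finset.mul_sum]
      ring
    have hz := fun z => ih (j + 1) (Function.update x (j + 1) z) (by omega)
    simp only [Function.update_self] at hz
    rw [hx, hQ (x j)]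
    constructor
    · have : ∑ z, K (x j) z * Q z - γ ^ (m + 1) * G ≤ ∑ z, K (x j) z *
          pathExp K (discountedSum γ c n (j + 1)) m (j + 1) (Function.update x (j + 1) z) := by
        calc _ = ∑ z, K (x j) z * (Q z - γ ^ (m + 1) * G) := by
              simp only [mul_sub, Finset.sum_sub_distrib, ← Finset.sum_mul, hK.sum_eq_one, one_mul]
          _ ≤ _ := Finset.sum_le_sum fun z _ =>
              mul_le_mul_of_nonneg_left (hz z).1 (hK.nonneg _ _)
      have := mul_le_mul_of_nonneg_left this h0
      rw [pow_succ' γ (m + 1)]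
      linarith
    · have : ∑ z, K (x j) z *
          pathExp K (discountedSum γ c n (j + 1)) m (j + 1) (Function.update x (j + 1) z) ≤
          ∑ z, K (x j) z * Q z :=
        Finset.sum_le_sum fun z _ => mul_le_mul_of_nonneg_left (hz z).2 (hK.nonneg _ _)
      have := mul_le_mul_of_nonneg_left this h0
      linarith

open Classical in
/-- The kernel `K` killed at `z`, acting on functions. -/
def killed (K : X → X → ℝ) (z : X) (f : X → ℝ) (w : X) : ℝ :=
  ∑ w', K w w' * if w' = z then 0 else f w'

/-- The probability of not visiting `z` at the times `1, …, r`. -/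
def avoidProb (K : X → X → ℝ) (z : X) (r : ℕ) : X → ℝ := (killed K z)^[r] fun _ => 1

lemma avoidProb_succ (z : X) (r : ℕ) : avoidProb K z (r + 1) = killed K z (avoidProb K z r) :=
  Function.iterate_succ_apply' _ _ _

lemma killed_mono (hK : IsStochastic K) (z : X) : Monotone (killed K z) := fun f g h w =>
  Finset.sum_le_sum fun w' _ => mul_le_mul_of_nonneg_left
    (by split_ifs; exacts [le_rfl, h w']) (hK.nonneg _ _)

lemma killed_smul (z : X) (b : ℝ) (f : X → ℝ) :
    killed K z (b • f) = b • killed K z f := by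
  ext w
  simp only [killed, Pi.smul_apply, smul_eq_mul, Finset.mul_sum]
  refine Finset.sum_congr rfl fun w' _ => ?_
  split_ifs <;> ring

/-- Markov property at time `r`: after surviving `r` steps, the next `m` are survived with
probability at most `b` from any position. Formally, the killed kernel is monotone and homogeneous.
-/
lemma avoidProb_add_le (hK : IsStochastic K) {z : X} {m : ℕ} {b : ℝ}
    (h : ∀ w, avoidProb K z m w ≤ b) (r : ℕ) (w : X) :
    avoidProb K z (r + m) w ≤ b * avoidProb K z r w := by
  induction r generalizing w with
  | zero => simpa [avoidProb] using h w
  | succ r ih =>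
    have h1 : killed K z (avoidProb K z (r + m)) ≤ killed K z (b • avoidProb K z r) :=
      killed_mono hK z fun w => ih w
    rw [killed_smul, ← avoidProb_succ, ← avoidProb_succ] at h1
    rw [show r + 1 + m = r + m + 1 by omega]
    exact h1 w

lemma avoidProb_mul_le (hK : IsStochastic K) {z : X} {m : ℕ} {b : ℝ} (hb : 0 ≤ b)
    (h : ∀ w, avoidProb K z m w ≤ b) (N : ℕ) (w : X) : avoidProb K z (m * N) w ≤ b ^ N := by
  induction N with
  | zero => simp [avoidProb]
  | succ N ih =>
    rw [mul_add_one, pow_succ']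
    exact (avoidProb_add_le hK h _ w).trans (mul_le_mul_of_nonneg_left ih hb)

/-- Avoiding `z` up to time `m + 1` is at most as likely as not being there at that time. -/
lemma avoidProb_le (hK : IsStochastic K) {z : X} {κ : ℕ → X → ℝ} (h0 : ∀ w, κ 0 w = K w z)
    (hs : ∀ m w, κ (m + 1) w = ∑ w', K w w' * κ m w') (h1 : ∀ m w, κ m w ≤ 1) (m : ℕ) (w : X) :
    avoidProb K z (m + 1) w ≤ 1 - κ m w := by
  classical
  induction m generalizing w with
  | zero =>
    rw [avoidProb_succ, h0, ← hK.sum_eq_one w, ← Finset.add_sum_erase _ _ (Finset.mem_univ z),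
      killed, ← Finset.add_sum_erase _ _ (Finset.mem_univ z), if_pos rfl]
    have : ∑ w' ∈ Finset.univ.erase z, (K w w' * if w' = z then 0 else avoidProb K z 0 w') =
        ∑ w' ∈ Finset.univ.erase z, K w w' := Finset.sum_congr rfl fun w' hw' => by
      rw [if_neg (Finset.ne_of_mem_erase hw')]
      simp [avoidProb]
    rw [this]
    linarith
  | succ m ih =>
    rw [avoidProb_succ, hs]
    -- Stepping into `z` itself contributes zero on the left and `1 - κ m z ≥ 0` on the right.
    calc killed K z (avoidProb K z (m + 1)) w ≤ ∑ w', K w w' * (1 - κ m w') :=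
          Finset.sum_le_sum fun w' _ => mul_le_mul_of_nonneg_left
            (by split_ifs; exacts [sub_nonneg.2 (h1 m w'), ih w']) (hK.nonneg _ _)
      _ = _ := by simp only [mul_sub, mul_one, Finset.sum_sub_distrib, hK.sum_eq_one]

end PathExpectation

/-! ### First visits and elementary bounds on the estimators -/

section FirstVisit

variable {S A : Type*}

lemma firstVisit_eq {n j : ℕ} {x : ℕ → S × A} {z : S × A} (hj : j < n) (hx : x j = z)
    (h : ∀ l < j, x l ≠ z) : firstVisit n x z = j := by
  have hex : ∃ t, t < n ∧ x t = z := ⟨j, hj, hx⟩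
  rw [firstVisit, dif_pos hex]
  classical
  refine (Nat.find_eq_iff hex).2 ⟨⟨hj, hx⟩, fun l hl h' => h l hl h'.2⟩

lemma firstVisit_eq_of_avoid {n : ℕ} {x : ℕ → S × A} {z : S × A}
    (h : ∀ l < n, x l ≠ z) : firstVisit n x z = n :=
  dif_neg fun ⟨t, ht, hx⟩ => h t ht hx

lemma firstVisit_congr {n : ℕ} {x y : ℕ → S × A} (h : ∀ l < n, x l = y l) (z : S × A) :
    firstVisit n x z = firstVisit n y z := by
  classical
  by_cases hv : ∃ t, t < n ∧ x t = z
  · have hs := Nat.find_spec hv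
    have hmin : ∀ l < Nat.find hv, x l ≠ z := fun l hl hx =>
      Nat.find_min hv hl ⟨hl.trans hs.1, hx⟩
    rw [firstVisit_eq hs.1 hs.2 hmin, firstVisit_eq hs.1 ((h _ hs.1).symm.trans hs.2)
      fun l hl => by rw [← h l (hl.trans hs.1)]; exact hmin l hl]
  · push Not at hv
    rw [firstVisit_eq_of_avoid hv,
      firstVisit_eq_of_avoid fun l hl => by rw [← h l hl]; exact hv l hl]

variable [Fintype S] [Fintype A]

lemma MDP.omc_eq_discountedSum (M : MDP S A) (n : ℕ) (x : ℕ → S × A) (z : S × A) :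
    M.omc n x z = discountedSum M.γ (fun z => M.cost z.1 z.2) n (firstVisit n x z) x := rfl

lemma MDP.omc_mem (M : MDP S A) (n : ℕ) (x : ℕ → S × A) (z : S × A) :
    M.omc n x z ∈ Set.Icc 0 (1 / (1 - M.γ)) :=
  discountedSum_mem (c := fun z : S × A => M.cost z.1 z.2) M.γ_pos M.γ_lt_one
    (fun z => M.cost_nonneg z.1 z.2) (fun z => M.cost_le_one z.1 z.2) _ _ _

lemma MDP.omc_congr (M : MDP S A) {n : ℕ} {x y : ℕ → S × A} (h : ∀ l < n, x l = y l)
    (z : S × A) : M.omc n x z = M.omc n y z := by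
  unfold MDP.omc
  rw [firstVisit_congr h z]
  refine Finset.sum_congr rfl fun t ht => ?_
  rw [h t (Finset.mem_Ico.1 ht).2]

lemma MDP.tomc_mem [DecidableEq S] (M : MDP S A) (n : ℕ) (θ : ℝ) (π : Policy S A)
    (x : ℕ → S × A) (s : S) (a : A) : M.tomc n θ π x s a ∈ Set.Icc 0 (1 / (1 - M.γ)) := by
  unfold MDP.tomc
  split_ifs
  · exact M.omc_mem _ _ _
  · exact ⟨(one_div_pos.2 M.one_sub_γ_pos).le, le_rfl⟩

lemma MDP.tomc_congr (M : MDP S A) {n : ℕ} (θ : ℝ) (π : Policy S A) {x y : ℕ → S × A}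
    (h : ∀ l < n, x l = y l) : M.tomc n θ π x = M.tomc n θ π y := by
  funext s a
  unfold MDP.tomc
  rw [M.omc_congr h]

end FirstVisit

/-! ### Bias of the first-visit Monte Carlo estimate -/

section Bias

variable {S A : Type*} [Fintype S] [DecidableEq S] [Fintype A]

/-- The transition kernel of the chain of state-action pairs. -/
def MDP.pairTrans (M : MDP S A) (π : Policy S A) (z z' : S × A) : ℝ :=
  M.trans z.1 z.2 z'.1 * (π z'.1).1 z'.2

lemma MDP.sum_pairTrans_mul (M : MDP S A) (π : Policy S A) (z : S × A) (f : S × A → ℝ) :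
    ∑ z', M.pairTrans π z z' * f z' =
      ∑ s', M.trans z.1 z.2 s' * ∑ a', (π s').1 a' * f (s', a') := by
  simp only [MDP.pairTrans, Fintype.sum_prod_type, Finset.mul_sum, mul_assoc]

lemma MDP.pairTrans_isStochastic (M : MDP S A) (π : Policy S A) :
    IsStochastic (M.pairTrans π) where
  nonneg z z' := mul_nonneg (M.trans_nonneg _ _ _) ((π z'.1).2.1 z'.2)
  sum_eq_one z := by
    have h := M.sum_pairTrans_mul π z fun _ => 1
    have h1 : ∀ s', ∑ a, (π s').1 a = 1 := fun s' => (π s').2.2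
    simp only [mul_one, h1, M.trans_sum] at h
    exact h

lemma MDP.qvalue_eq (M : MDP S A) (π : Policy S A) (z : S × A) :
    M.qvalue π z = M.cost z.1 z.2 + M.γ * ∑ z', M.pairTrans π z z' * M.qvalue π z' := by
  rw [M.sum_pairTrans_mul]
  simp only [← M.value_eq_sum_qvalue]
  rfl

/-- Costs are nonnegative, so cutting the sum off at time `n`, or returning zero without a visit,
can only underestimate `Q`. This sign is what makes the comparison with `πs` free of bias terms
later. -/
lemma MDP.pathExp_bias_nonneg (M : MDP S A) (π : Policy S A) (z : S × A) {n : ℕ} (m : ℕ) :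
    ∀ (j : ℕ) (x : ℕ → S × A), n = j + m + 1 → (∀ l < j, x l ≠ z) →
      pathExp (M.pairTrans π) (fun y => M.omc n y z) m j x ≤ M.qvalue π z := by
  classical
  have hK := M.pairTrans_isStochastic π
  have hvisit : ∀ (m j : ℕ) (x : ℕ → S × A), n = j + m + 1 → (∀ l < j, x l ≠ z) → x j = z →
      pathExp (M.pairTrans π) (fun y => M.omc n y z) m j x ≤ M.qvalue π z := by
    intro m j x hn hx hxj
    have h := (pathExp_discountedSum_mem hK M.γ_pos.le (M.qvalue_eq π) (M.qvalue_nonneg π)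
      (M.qvalue_le π) m j x hn).2
    rw [hxj] at h
    refine le_trans (le_of_eq ?_) h
    refine pathExp_congr hK _ _ _ fun y hy => ?_
    rw [M.omc_eq_discountedSum, firstVisit_eq (j := j) (by omega) ((hy j le_rfl).trans hxj)
      fun l hl => by rw [hy l hl.le]; exact hx l hl]
  induction m with
  | zero =>
    intro j x hn hx
    by_cases hxj : x j = z
    · exact hvisit 0 j x hn hx hxj
    · have : pathExp (M.pairTrans π) (fun y => M.omc n y z) 0 j x = 0 := by
        rw [pathExp, M.omc_eq_discountedSum, firstVisit_eq_of_avoid, discountedSum_self]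
        intro l hl
        rcases Nat.lt_succ_iff_lt_or_eq.1 (show l < j + 1 by omega) with h | h
        · exact hx l h
        · rwa [h]
      rw [this]
      exact M.qvalue_nonneg π z
  | succ m ih =>
    intro j x hn hx
    by_cases hxj : x j = z
    · exact hvisit (m + 1) j x hn hx hxj
    · refine hK.sum_mul_le (fun w => ih (j + 1) _ (by omega) fun l hl => ?_) _
      rw [Function.update_of_ne (by omega)]
      rcases Nat.lt_succ_iff_lt_or_eq.1 hl with h | h
      · exact hx l h
      · rwa [h]

-- Here `r` is a deadline for the first visit. If `z` is met within `r` steps, at least `m + 1 - r`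
-- terms are collected and only the discounted tail is lost; if not, at most the maximal value `1 /
-- (1 - γ)` of `Q` is lost. Each step that misses `z` uses up one unit of both `m` and `r`.
open Classical in
lemma MDP.pathExp_bias_le (M : MDP S A) (π : Policy S A) (z : S × A) {n : ℕ} (m : ℕ) :
    ∀ (r j : ℕ) (x : ℕ → S × A), r ≤ m → n = j + m + 1 → (∀ l < j, x l ≠ z) →
      M.qvalue π z - pathExp (M.pairTrans π) (fun y => M.omc n y z) m j x ≤
        1 / (1 - M.γ) * (M.γ ^ (m + 1 - r) +
          if x j = z then 0 else avoidProb (M.pairTrans π) z r (x j)) := by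
  have hK := M.pairTrans_isStochastic π
  have hG : 0 < 1 / (1 - M.γ) := one_div_pos.2 M.one_sub_γ_pos
  have hvisit : ∀ (m r j : ℕ) (x : ℕ → S × A), r ≤ m → n = j + m + 1 → (∀ l < j, x l ≠ z) →
      x j = z → M.qvalue π z - pathExp (M.pairTrans π) (fun y => M.omc n y z) m j x ≤
        1 / (1 - M.γ) * (M.γ ^ (m + 1 - r) +
          if x j = z then 0 else avoidProb (M.pairTrans π) z r (x j)) := by
    intro m r j x hr hn hx hxj
    have h := (pathExp_discountedSum_mem hK M.γ_pos.le (M.qvalue_eq π) (M.qvalue_nonneg π)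
      (M.qvalue_le π) m j x hn).1
    rw [if_pos hxj, add_zero]
    rw [hxj] at h
    have he : pathExp (M.pairTrans π) (discountedSum M.γ (fun z => M.cost z.1 z.2) n j) m j x =
        pathExp (M.pairTrans π) (fun y => M.omc n y z) m j x := by
      refine pathExp_congr hK _ _ _ fun y hy => ?_
      rw [M.omc_eq_discountedSum, firstVisit_eq (j := j) (by omega) ((hy j le_rfl).trans hxj)
        fun l hl => by rw [hy l hl.le]; exact hx l hl]
    rw [he] at h
    have hp : M.γ ^ (m + 1) ≤ M.γ ^ (m + 1 - r) :=
      pow_le_pow_of_le_one M.γ_pos.le M.γ_lt_one.le (Nat.sub_le _ _)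
    have := mul_le_mul_of_nonneg_left hp hG.le
    linarith
  have hzero : ∀ (m j : ℕ) (x : ℕ → S × A), x j ≠ z →
      M.qvalue π z - pathExp (M.pairTrans π) (fun y => M.omc n y z) m j x ≤
        1 / (1 - M.γ) * (M.γ ^ (m + 1 - 0) +
          if x j = z then 0 else avoidProb (M.pairTrans π) z 0 (x j)) := by
    intro m j x hxj
    rw [if_neg hxj, show avoidProb (M.pairTrans π) z 0 (x j) = 1 from rfl, mul_add, mul_one]
    have h1 := le_pathExp hK (fun y => (M.omc_mem n y z).1) m j x
    have h2 := M.qvalue_le π z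
    have h3 : 0 ≤ 1 / (1 - M.γ) * M.γ ^ (m + 1 - 0) :=
      mul_nonneg hG.le (pow_nonneg M.γ_pos.le _)
    linarith
  induction m with
  | zero =>
    intro r j x hr hn hx
    by_cases hxj : x j = z
    · exact hvisit 0 r j x hr hn hx hxj
    · obtain rfl : r = 0 := by omega
      exact hzero 0 j x hxj
  | succ m ih =>
    intro r j x hr hn hx
    by_cases hxj : x j = z
    · exact hvisit (m + 1) r j x hr hn hx hxj
    cases r with
    | zero => exact hzero (m + 1) j x hxj
    | succ r =>
      have hw : ∀ w, M.qvalue π z - pathExp (M.pairTrans π) (fun y => M.omc n y z) m (j + 1)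
          (Function.update x (j + 1) w) ≤ 1 / (1 - M.γ) * (M.γ ^ (m + 1 - r) +
          if w = z then 0 else avoidProb (M.pairTrans π) z r w) := fun w => by
        have := ih r (j + 1) (Function.update x (j + 1) w) (by omega) (by omega) fun l hl => by
          rw [Function.update_of_ne (by omega)]
          rcases Nat.lt_succ_iff_lt_or_eq.1 hl with h | h
          · exact hx l h
          · rwa [h]
        simpa only [Function.update_self] using this
      rw [if_neg hxj, avoidProb_succ, show m + 1 + 1 - (r + 1) = m + 1 - r by omega, pathExp]
      calc _ = ∑ w, M.pairTrans π (x j) w * (M.qvalue π z - pathExp (M.pairTrans π)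
              (fun y => M.omc n y z) m (j + 1) (Function.update x (j + 1) w)) := by
            simp only [mul_sub, Finset.sum_sub_distrib, ← Finset.sum_mul, hK.sum_eq_one, one_mul]
        _ ≤ ∑ w, M.pairTrans π (x j) w * (1 / (1 - M.γ) * (M.γ ^ (m + 1 - r) +
              if w = z then 0 else avoidProb (M.pairTrans π) z r w)) :=
            Finset.sum_le_sum fun w _ => mul_le_mul_of_nonneg_left (hw w) (hK.nonneg _ _)
        _ = _ := by
            simp only [mul_left_comm _ (1 / (1 - M.γ)), ← Finset.mul_sum, mul_add,
              Finset.sum_add_distrib, ← Finset.sum_mul, hK.sum_eq_one, one_mul,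
              killed]
            congr!

/-- Under geometric mixing, a state-action pair is avoided during a block of `b + 1` steps with
probability bounded away from one. -/
lemma MDP.avoidProb_le_of_mixes (M : MDP S A) {π : Policy S A} {C ρ νmin θ : ℝ}
    (hmix : M.MixesWith π C ρ νmin) (hν : 0 < νmin) (hθ : 0 < θ) {s : S} {a : A}
    (ha : θ ≤ (π s).1 a) {b : ℕ} (hb : C * ρ ^ (b + 1) ≤ νmin / 2) (w : S × A) :
    avoidProb (M.pairTrans π) (s, a) (b + 1) w ≤ 1 - νmin * θ / 2 := by
  obtain ⟨ν, hνs, -, hgeo, hmin⟩ := hmix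
  have hK := M.pairTrans_isStochastic π
  -- The probability of being at `(s, a)` after `m + 1` steps of the pair chain: one transition from
  -- the given pair, `m` steps of the state chain, then the choice of `a`.
  let κ : ℕ → S × A → ℝ := fun m w =>
    ∑ s', M.trans w.1 w.2 s' * ((M.stateTrans π ^ m) s' s * (π s).1 a)
  have hπ1 : (π s).1 a ≤ 1 := by
    rw [← (π s).2.2]
    exact Finset.single_le_sum (f := fun a => (π s).1 a) (fun b _ => (π s).2.1 b)
      (Finset.mem_univ a)
  have hκ0 : ∀ w, κ 0 w = M.pairTrans π w (s, a) := fun w => by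
    simp [κ, Matrix.one_apply, MDP.pairTrans]
  have hκs : ∀ m w, κ (m + 1) w = ∑ w', M.pairTrans π w w' * κ m w' := fun m w => by
    rw [M.sum_pairTrans_mul]
    refine Finset.sum_congr rfl fun s' _ => ?_
    congr 1
    rw [pow_succ', Matrix.mul_apply, Finset.sum_mul]
    simp only [κ, MDP.stateTrans, Matrix.of_apply, Finset.mul_sum, Finset.sum_mul]
    rw [Finset.sum_comm]
    refine Finset.sum_congr rfl fun _ _ => Finset.sum_congr rfl fun _ _ => by ring
  have hκ1 : ∀ m w, κ m w ≤ 1 := fun m w => by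
    calc κ m w ≤ ∑ s', M.trans w.1 w.2 s' * 1 := Finset.sum_le_sum fun s' _ =>
          mul_le_mul_of_nonneg_left (mul_le_one₀ (M.stateTrans_pow_le_one π m s' s)
            ((π s).2.1 a) hπ1) (M.trans_nonneg _ _ _)
      _ = 1 := by simp only [mul_one, M.trans_sum]
  refine (avoidProb_le hK hκ0 hκs hκ1 b w).trans ?_
  have hlow : ∀ s', νmin / 2 ≤ (M.stateTrans π ^ b) s' s := fun s' => by
    have h1 : |(M.stateTrans π ^ b) s' s - ν s| ≤ νmin / 2 :=
      (Finset.single_le_sum (f := fun s => |(M.stateTrans π ^ b) s' s - ν s|)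
        (fun _ _ => abs_nonneg _) (Finset.mem_univ s)).trans ((hgeo s' b).trans hb)
    linarith [(abs_le.1 h1).1, hmin s]
  have : νmin / 2 * θ ≤ κ b w := by
    calc νmin / 2 * θ = ∑ s', M.trans w.1 w.2 s' * (νmin / 2 * θ) := by
          rw [← Finset.sum_mul, M.trans_sum, one_mul]
      _ ≤ κ b w := Finset.sum_le_sum fun s' _ => mul_le_mul_of_nonneg_left
          (mul_le_mul (hlow s') ha hθ.le ((half_pos hν).le.trans (hlow s'))) (M.trans_nonneg _ _ _)
  linarith

/-- The trajectory is divided into `N` blocks of length `b`, each missing the pair with probability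
at most `1 - p / 2`, and a remainder in which the discounted tail decays. With `N = ⌈4 * L / p⌉₊`
the blocks use at most `6 * (H * L)` steps, so at least `4 * (H * L)` remain, and both error terms
are at most `exp (-(2 * L))`. -/
lemma exists_block_count {g p a ε H L : ℝ} (hg : 0 < g) (hg1 : g < 1) (hp : 0 < p) (hp1 : p ≤ 1)
    (ha : 1 ≤ a) (hε : 0 < ε) {b n : ℕ} (hb : 1 ≤ b) (hH : H = 1 / g + b / p)
    (hL : L = Real.log (2 + H * a / ε)) (hn : 10 * (H * L) ≤ n) :
    ∃ N : ℕ, b * N + 1 ≤ n ∧ 1 / g * ((1 - g) ^ (n - b * N) + (1 - p / 2) ^ N) ≤ ε / 2 := by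
  have hb' : (1 : ℝ) ≤ b := by exact_mod_cast hb
  have hbp : (b : ℝ) ≤ b / p := by rw [le_div_iff₀ hp]; nlinarith
  have hg' : 1 < 1 / g := by rw [lt_div_iff₀ hg]; linarith
  have hH1 : 1 ≤ H := by rw [hH]; linarith
  have hx : 0 < H * a / ε := by positivity
  have hL2 : 1 / 2 ≤ L := by
    have h1 := Real.log_two_gt_d9
    have h2 : Real.log 2 ≤ L := by rw [hL]; exact Real.log_le_log two_pos (by linarith)
    linarith
  have hL0 : 0 < L := by linarith
  have hN1 := Nat.le_ceil (4 * L / p)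
  have hN2 := (Nat.ceil_lt_add_one (a := 4 * L / p) (by positivity)).le
  set N := ⌈4 * L / p⌉₊
  have hbN : (b : ℝ) * N ≤ 6 * (H * L) := by
    have h1 : (b : ℝ) * N ≤ b * (4 * L / p + 1) := mul_le_mul_of_nonneg_left hN2 (by positivity)
    have h2 : (b : ℝ) * (4 * L / p + 1) = 4 * L * (b / p) + b := by ring
    have h3 : b / p ≤ H := by rw [hH]; linarith
    have h4 : (b : ℝ) ≤ 2 * L * H := by nlinarith
    nlinarith
  have hHL : 1 / 2 ≤ H * L := by nlinarith
  have hlt : b * N + 1 ≤ n := by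
    have : ((b * N + 1 : ℕ) : ℝ) ≤ n := by push_cast; linarith
    exact_mod_cast this
  refine ⟨N, hlt, ?_⟩
  have hsub : ((n - b * N : ℕ) : ℝ) = n - b * N := by
    rw [Nat.cast_sub (by omega)]; push_cast; ring
  have hgH : 1 ≤ g * H := by
    have : g * (1 / g) = 1 := by field_simp
    have h3 : 1 / g ≤ H := by rw [hH]; linarith
    nlinarith
  have e1 : (1 - g) ^ (n - b * N) ≤ Real.exp (-(2 * L)) := by
    calc (1 - g) ^ (n - b * N) ≤ Real.exp (-g) ^ (n - b * N) :=
          pow_le_pow_left₀ (by linarith) (by linarith [Real.add_one_le_exp (-g)]) _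
      _ = Real.exp (-(g * (n - b * N))) := by
          rw [← Real.exp_nat_mul, hsub]; congr 1; ring
      _ ≤ _ := by
          rw [Real.exp_le_exp, neg_le_neg_iff]
          have : 4 * (H * L) ≤ n - b * N := by linarith
          have := mul_le_mul_of_nonneg_left this hg.le
          nlinarith
  have e2 : (1 - p / 2) ^ N ≤ Real.exp (-(2 * L)) := by
    calc (1 - p / 2) ^ N ≤ Real.exp (-(p / 2)) ^ N :=
          pow_le_pow_left₀ (by linarith) (by linarith [Real.add_one_le_exp (-(p / 2))]) _
      _ = Real.exp (-(p / 2 * N)) := by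
          rw [← Real.exp_nat_mul]; congr 1; ring
      _ ≤ _ := by
          rw [Real.exp_le_exp, neg_le_neg_iff]
          rw [div_le_iff₀ hp] at hN1
          linarith
  have e3 : Real.exp (-(2 * L)) = 1 / (2 + H * a / ε) ^ 2 := by
    rw [Real.exp_neg, two_mul, Real.exp_add, hL, Real.exp_log (by positivity), one_div, sq]
  -- Squaring the argument of the logarithm leaves a cross term `4 * (H * a / ε)`; multiplied by `ε`
  -- it dominates `4 / g`, since `H` contains `1 / g`.
  have e4 : 1 / g * (1 / (2 + H * a / ε) ^ 2 + 1 / (2 + H * a / ε) ^ 2) ≤ ε / 2 := by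
    have h5 : 1 / g ≤ H * a := by
      have h3 : 1 / g ≤ H := by rw [hH]; linarith
      nlinarith
    have h6 : ε * (H * a / ε) = H * a := by field_simp
    have h7 : 4 * (1 / g) ≤ ε * (2 + H * a / ε) ^ 2 := by nlinarith [sq_nonneg (H * a / ε)]
    have h8 : 0 < (2 + H * a / ε) ^ 2 := by positivity
    rw [← add_div, ← mul_div_assoc, div_le_iff₀ h8]
    linarith
  rw [← e3] at e4
  exact (mul_le_mul_of_nonneg_left (add_le_add e1 e2) (by positivity)).trans e4

/-- The bias of the Monte Carlo estimate along a sufficiently long trajectory. -/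
lemma MDP.bias_mem [Nonempty A] (M : MDP S A) {π : Policy S A} {C ρ νmin θ ε : ℝ} (hC : 0 < C)
    (hρ : 0 < ρ) (hρ1 : ρ < 1) (hν : 0 < νmin) (hθ : 0 < θ) (hθ1 : θ ≤ 1) (hε : 0 < ε)
    (hmix : M.MixesWith π C ρ νmin) {n : ℕ}
    (hn : 10 * M.lengthOrder C ρ νmin θ ε ≤ n) {s : S} {a : A} (ha : θ ≤ (π s).1 a)
    (x : ℕ → S × A) :
    M.qvalue π (s, a) - pathExp (M.pairTrans π) (fun y => M.omc n y (s, a)) (n - 1) 0 x ∈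
      Set.Icc 0 (ε / 2) := by
  have hν1 : νmin ≤ 1 := by
    obtain ⟨ν, hνs, -, -, hmin⟩ := hmix
    refine (hmin s).trans ?_
    rw [← hνs.2]
    exact Finset.single_le_sum (fun b _ => hνs.1 b) (Finset.mem_univ s)
  have hp : 0 < νmin * θ := mul_pos hν hθ
  have hp1 : νmin * θ ≤ 1 := mul_le_one₀ hν1 hθ.le hθ1
  obtain ⟨N, hN, hle⟩ := exists_block_count (g := 1 - M.γ) (p := νmin * θ)
    (a := Fintype.card A) (ε := ε) (b := max 1 ⌈Real.logb ρ (νmin * θ / (2 * C))⌉₊) (n := n)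
    M.one_sub_γ_pos (by linarith [M.γ_pos]) hp hp1
    (by exact_mod_cast Fintype.card_pos) hε (le_max_left _ _) rfl rfl hn
  set b := max 1 ⌈Real.logb ρ (νmin * θ / (2 * C))⌉₊ with hb
  have hbpos : 1 ≤ b := le_max_left _ _
  -- A block of `b` pair steps contains `b - 1` state-chain steps after the initial transition, and
  -- the mixing bound at lag `b - 1` carries the exponent `b`.
  have hCb : C * ρ ^ (b - 1 + 1) ≤ νmin / 2 := by
    rw [Nat.sub_add_cancel hbpos]
    have h1 : Real.logb ρ (νmin * θ / (2 * C)) ≤ b :=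
      (Nat.le_ceil _).trans (by exact_mod_cast le_max_right _ _)
    have h2 : ρ ^ b ≤ νmin * θ / (2 * C) := by
      rw [← Real.rpow_natCast]
      exact (Real.logb_le_iff_le_rpow_of_base_lt_one hρ hρ1 (by positivity)).1 h1
    have h3 : C * ρ ^ b ≤ C * (νmin * θ / (2 * C)) := mul_le_mul_of_nonneg_left h2 hC.le
    have h4 : C * (νmin * θ / (2 * C)) = νmin * θ / 2 := by field_simp
    have h5 : νmin * θ ≤ νmin := mul_le_of_le_one_right hν.le hθ1
    linarith
  have hK := M.pairTrans_isStochastic π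
  have hav := M.avoidProb_le_of_mixes hmix hν hθ ha hCb
  rw [Nat.sub_add_cancel hbpos] at hav
  have hN' := avoidProb_mul_le hK (by linarith : 0 ≤ 1 - νmin * θ / 2) hav N
  refine ⟨sub_nonneg.2 (M.pathExp_bias_nonneg π (s, a) (n - 1) 0 x (by omega) (by omega)), ?_⟩
  refine (M.pathExp_bias_le π (s, a) (n - 1) (b * N) 0 x (by omega) (by omega)
    (by omega)).trans (le_trans ?_ hle)
  refine mul_le_mul_of_nonneg_left ?_ (one_div_pos.2 M.one_sub_γ_pos).le
  rw [show n - 1 + 1 - b * N = n - b * N by omega, sub_sub_cancel]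
  refine add_le_add le_rfl ?_
  split_ifs
  · exact pow_nonneg (by linarith) _
  · exact hN' _

end Bias

/-! ### Dependence on finite prefixes and splitting of integrals -/

section Locality

variable {X : Type*} [Fintype X]

lemma pathExp_congr_start {K : X → X → ℝ} {g : (ℕ → X) → ℝ} {n : ℕ}
    (hg : ∀ x y : ℕ → X, (∀ l < n, x l = y l) → g x = g y) (m : ℕ) :
    ∀ (j : ℕ) (x y : ℕ → X), n = j + m + 1 → (∀ l ≤ j, x l = y l) →
      pathExp K g m j x = pathExp K g m j y := by
  induction m with
  | zero => exact fun j x y hn h => hg x y fun l hl => h l (by omega)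
  | succ m ih =>
    intro j x y hn h
    simp only [pathExp, h j le_rfl]
    refine Finset.sum_congr rfl fun z _ => ?_
    rw [ih (j + 1) (Function.update x (j + 1) z) (Function.update y (j + 1) z) (by omega)]
    intro l hl
    by_cases hlj : l = j + 1
    · rw [hlj, Function.update_self, Function.update_self]
    · rw [Function.update_of_ne hlj, Function.update_of_ne hlj, h l (by omega)]

lemma pathExp_nonneg {K : X → X → ℝ} (hK : IsStochastic K) {g : (ℕ → X) → ℝ}
    (h : ∀ y, 0 ≤ g y) (m j : ℕ) (x : ℕ → X) : 0 ≤ pathExp K g m j x :=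
  le_pathExp hK h m j x

lemma setLIntegral_eq_sum_fiber {Ω ι : Type*} [MeasurableSpace Ω] [Fintype ι] (ℙ : Measure Ω)
    {s : Set Ω} (hs : MeasurableSet s) (f : Ω → ι) (hf : ∀ i, MeasurableSet {ω | f ω = i})
    (g : Ω → ENNReal) :
    ∫⁻ ω in s, g ω ∂ℙ = ∑ i, ∫⁻ ω in s ∩ {ω | f ω = i}, g ω ∂ℙ := by
  have hU : s = ⋃ i, s ∩ {ω | f ω = i} := by
    ext ω
    simp
  conv_lhs => rw [hU]
  rw [lintegral_iUnion (fun i => hs.inter (hf i)), tsum_fintype]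
  intro i j hij
  refine Set.disjoint_left.2 fun ω h1 h2 => hij ?_
  exact h1.2.symm.trans h2.2

end Locality

/-! ### Conditioning on the past and exponential moments along a run -/

section Run

variable {S A : Type*} [Fintype S] [DecidableEq S] [Fintype A]
  {M : MDP S A} {W : DistGen A} {η θ : ℝ} {n k : ℕ} {π₀ : Policy S A}
  {Ω : Type*} [MeasurableSpace Ω] {ℙ : Measure Ω}
  {Z : ℕ → ℕ → Ω → S × A} {π : ℕ → Ω → Policy S A}

/-- The outcomes that share the first `t` trajectories with `ω₀`. -/
def pastEvent (Z : ℕ → ℕ → Ω → S × A) (n t : ℕ) (ω₀ : Ω) : Set Ω :=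
  {ω | ∀ i < t, ∀ l < n, Z i l ω = Z i l ω₀}

/-- The outcomes that share the first `t` trajectories and the next one up to time `j`
with `ω₀`. -/
def historyEvent (Z : ℕ → ℕ → Ω → S × A) (n t j : ℕ) (ω₀ : Ω) : Set Ω :=
  {ω | (∀ i < t, ∀ l < n, Z i l ω = Z i l ω₀) ∧ ∀ l ≤ j, Z t l ω = Z t l ω₀}

lemma IsRun.isInterior (h : IsRun M W η θ n k π₀ ℙ Z π) {μ : ℝ} {τ : ℝ → ℝ}
    (hD : DivergenceCondition M W μ τ) (hη : 0 ≤ η) (hπ₀ : π₀.IsInterior) {t : ℕ} (ht : t ≤ k)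
    (ω : Ω) : (π t ω).IsInterior := by
  induction t with
  | zero => rw [h.init]; exact hπ₀
  | succ t ih =>
    exact fun s => hD.prox_interior hη (ih (by omega) s) (h.update t (by omega) ω s)

/-- The policy of iteration `t` is a function of the previous trajectories. -/
lemma IsRun.policy_eq (h : IsRun M W η θ n k π₀ ℙ Z π) {t : ℕ} (ht : t ≤ k) {ω ω' : Ω}
    (hω : ω ∈ pastEvent Z n t ω') : π t ω = π t ω' := by
  induction t with
  | zero => rw [h.init, h.init]
  | succ t ih =>
    have he := ih (by omega) fun i hi => hω i (by omega)
    funext s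
    have h1 := h.update t (by omega) ω s
    have h2 := h.update t (by omega) ω' s
    rw [he, M.tomc_congr θ (π t ω') (hω t (by omega))] at h1
    exact Subtype.ext (W.prox_unique h1 h2)

lemma IsRun.measurableSet_past_fiber (h : IsRun M W η θ n k π₀ ℙ Z π) {t : ℕ} (ht : t ≤ k)
    (b : Fin t → Fin n → S × A) :
    MeasurableSet {ω | (fun (i : Fin t) (l : Fin n) => Z i l ω) = b} := by
  have : {ω | (fun (i : Fin t) (l : Fin n) => Z i l ω) = b} =
      ⋂ (i : Fin t) (l : Fin n), {ω | Z i l ω = b i l} := by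
    ext ω
    simp [funext_iff]
  rw [this]
  exact MeasurableSet.iInter fun i => MeasurableSet.iInter fun l =>
    h.measurable i (by omega) l l.2 _

lemma past_fiber_eq (Z : ℕ → ℕ → Ω → S × A) (n t : ℕ) (ω₀ : Ω) :
    {ω | (fun (i : Fin t) (l : Fin n) => Z i l ω) =
      fun (i : Fin t) (l : Fin n) => Z i l ω₀} = pastEvent Z n t ω₀ := by
  ext ω
  simp only [funext_iff, Set.mem_ofPred_eq, pastEvent]
  exact ⟨fun h i hi l hl => h ⟨i, hi⟩ ⟨l, hl⟩, fun h i l => h i i.2 l l.2⟩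

lemma IsRun.measurableSet_pastEvent (h : IsRun M W η θ n k π₀ ℙ Z π) {t : ℕ} (ht : t ≤ k)
    (ω₀ : Ω) : MeasurableSet (pastEvent Z n t ω₀) := by
  rw [← past_fiber_eq]
  exact h.measurableSet_past_fiber ht _

/-- Events determined by the first `t` trajectories are measurable. -/
lemma IsRun.measurableSet_of_past (h : IsRun M W η θ n k π₀ ℙ Z π) {t : ℕ} (ht : t ≤ k)
    {U : Set Ω} (hU : ∀ ω ∈ U, pastEvent Z n t ω ⊆ U) : MeasurableSet U := by
  have : U = ⋃ b ∈ (fun ω => (fun (i : Fin t) (l : Fin n) => Z i l ω)) '' U,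
      {ω | (fun (i : Fin t) (l : Fin n) => Z i l ω) = b} := by
    ext ω
    simp only [Set.mem_iUnion, Set.mem_image, Set.mem_ofPred_eq, exists_prop]
    constructor
    · exact fun hω => ⟨_, ⟨ω, hω, rfl⟩, rfl⟩
    · rintro ⟨_, ⟨ω', hω', rfl⟩, he⟩
      refine hU ω' hω' ?_
      rw [← past_fiber_eq]
      exact he
  rw [this]
  exact MeasurableSet.biUnion (Set.to_countable _) fun b _ => h.measurableSet_past_fiber ht b

lemma IsRun.measurableSet_historyEvent (h : IsRun M W η θ n k π₀ ℙ Z π) {t j : ℕ} (ht : t < k)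
    (hj : j < n) (ω₀ : Ω) : MeasurableSet (historyEvent Z n t j ω₀) := by
  have : historyEvent Z n t j ω₀ = pastEvent Z n t ω₀ ∩
      ⋂ l : Fin (j + 1), {ω | Z t l ω = Z t l ω₀} := by
    ext ω
    simp only [historyEvent, pastEvent, Set.mem_ofPred_eq, Set.mem_inter_iff, Set.mem_iInter]
    exact and_congr Iff.rfl ⟨fun h l => h l (by omega), fun h l hl => h ⟨l, by omega⟩⟩
  rw [this]
  exact (h.measurableSet_pastEvent ht.le ω₀).inter
    (MeasurableSet.iInter fun l => h.measurable t ht l (by omega) _)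

/-- Conditionally on an initial part of the current trajectory, expectations are path expectations of
the chain of state-action pairs. -/
lemma IsRun.setLIntegral_historyEvent (h : IsRun M W η θ n k π₀ ℙ Z π) {t : ℕ} (ht : t < k)
    {g : (ℕ → S × A) → ℝ} (hg0 : ∀ y, 0 ≤ g y)
    (hg : ∀ x y : ℕ → S × A, (∀ l < n, x l = y l) → g x = g y) (m : ℕ) :
    ∀ (j : ℕ) (ω₀ : Ω), n = j + m + 1 →
      ∫⁻ ω in historyEvent Z n t j ω₀, ENNReal.ofReal (g fun l => Z t l ω) ∂ℙ =
        ℙ (historyEvent Z n t j ω₀) * ENNReal.ofReal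
          (pathExp (M.pairTrans (π t ω₀)) g m j fun l => Z t l ω₀) := by
  induction m with
  | zero =>
    intro j ω₀ hn
    rw [setLIntegral_congr_fun (g := fun _ => ENNReal.ofReal (g fun l => Z t l ω₀))
      (h.measurableSet_historyEvent ht (by omega) ω₀), setLIntegral_const, mul_comm, pathExp]
    intro ω hω
    simp only
    rw [hg (fun l => Z t l ω) (fun l => Z t l ω₀) fun l hl => hω.2 l (by omega)]
  | succ m ih =>
    intro j ω₀ hn
    have hK := M.pairTrans_isStochastic (π t ω₀)
    rw [setLIntegral_eq_sum_fiber ℙ (h.measurableSet_historyEvent ht (by omega) ω₀)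
      (Z t (j + 1)) (h.measurable t ht (j + 1) (by omega)), pathExp,
      ENNReal.ofReal_sum_of_nonneg (fun z _ => mul_nonneg (hK.nonneg _ _)
        (pathExp_nonneg hK hg0 _ _ _)), Finset.mul_sum]
    refine Finset.sum_congr rfl fun z _ => ?_
    rw [ENNReal.ofReal_mul (hK.nonneg _ _), ← mul_assoc]
    have hmk : ℙ (historyEvent Z n t j ω₀ ∩ {ω | Z t (j + 1) ω = z}) =
        ℙ (historyEvent Z n t j ω₀) *
          ENNReal.ofReal (M.pairTrans (π t ω₀) (Z t j ω₀) z) := by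
      refine Eq.trans ?_ (h.markov t ht j (by omega) ω₀ z)
      congr 1
      ext ω
      simp [historyEvent, and_assoc]
    rw [← hmk]
    -- An empty fiber contributes zero on both sides. A nonempty one is the history event of any of
    -- its points one step later, with the same policy, so the induction hypothesis applies.
    rcases Set.eq_empty_or_nonempty (historyEvent Z n t j ω₀ ∩ {ω | Z t (j + 1) ω = z}) with
      he | ⟨ω₁, hω₁, hz⟩
    · rw [he]; simp
    · have hset : historyEvent Z n t j ω₀ ∩ {ω | Z t (j + 1) ω = z} =
          historyEvent Z n t (j + 1) ω₁ := by
        ext ω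
        constructor
        · rintro ⟨h1, h2⟩
          refine ⟨fun i hi l hl => (h1.1 i hi l hl).trans (hω₁.1 i hi l hl).symm, fun l hl => ?_⟩
          rcases Nat.le_succ_iff.1 hl with h3 | h3
          · exact (h1.2 l h3).trans (hω₁.2 l h3).symm
          · rw [h3]; exact h2.trans hz.symm
        · rintro ⟨h1, h2⟩
          exact ⟨⟨fun i hi l hl => (h1 i hi l hl).trans (hω₁.1 i hi l hl),
            fun l hl => (h2 l (by omega)).trans (hω₁.2 l hl)⟩, (h2 (j + 1) le_rfl).trans hz⟩
      rw [hset, ih (j + 1) ω₁ (by omega), h.policy_eq ht.le hω₁.1]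
      congr 2
      refine pathExp_congr_start hg m (j + 1) _ _ (by omega) fun l hl => ?_
      rcases Nat.le_succ_iff.1 hl with h3 | h3
      · rw [Function.update_of_ne (by omega)]; exact hω₁.2 l h3
      · rw [h3, Function.update_self]; exact hz

/-- The law of the initial pair is unspecified, so one splits over its value and uses a bound that
is uniform in the starting point. -/
lemma IsRun.setLIntegral_pastEvent_le (h : IsRun M W η θ n k π₀ ℙ Z π) (hn : 0 < n) {t : ℕ}
    (ht : t < k) {g : (ℕ → S × A) → ℝ} (hg0 : ∀ y, 0 ≤ g y)
    (hg : ∀ x y : ℕ → S × A, (∀ l < n, x l = y l) → g x = g y) (ω₀ : Ω) {c : ℝ}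
    (hc : ∀ x, pathExp (M.pairTrans (π t ω₀)) g (n - 1) 0 x ≤ c) :
    ∫⁻ ω in pastEvent Z n t ω₀, ENNReal.ofReal (g fun l => Z t l ω) ∂ℙ ≤
      ENNReal.ofReal c * ℙ (pastEvent Z n t ω₀) := by
  have hm := h.measurableSet_pastEvent ht.le ω₀
  have hP : ENNReal.ofReal c * ℙ (pastEvent Z n t ω₀) =
      ∑ z, ENNReal.ofReal c * ℙ (pastEvent Z n t ω₀ ∩ {ω | Z t 0 ω = z}) := by
    rw [← Finset.mul_sum, ← setLIntegral_one,
      setLIntegral_eq_sum_fiber ℙ hm (Z t 0) (h.measurable t ht 0 hn)]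
    simp only [setLIntegral_one]
  rw [hP, setLIntegral_eq_sum_fiber ℙ hm (Z t 0) (h.measurable t ht 0 hn)]
  refine Finset.sum_le_sum fun z _ => ?_
  rcases Set.eq_empty_or_nonempty (pastEvent Z n t ω₀ ∩ {ω | Z t 0 ω = z}) with
    he | ⟨ω₁, hω₁, hz⟩
  · rw [he]; simp
  · have hset : pastEvent Z n t ω₀ ∩ {ω | Z t 0 ω = z} = historyEvent Z n t 0 ω₁ := by
      ext ω
      constructor
      · rintro ⟨h1, h2⟩
        refine ⟨fun i hi l hl => (h1 i hi l hl).trans (hω₁ i hi l hl).symm, fun l hl => ?_⟩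
        rw [Nat.le_zero.1 hl]
        exact h2.trans hz.symm
      · rintro ⟨h1, h2⟩
        exact ⟨fun i hi l hl => (h1 i hi l hl).trans (hω₁ i hi l hl),
          (h2 0 le_rfl).trans hz⟩
    rw [hset, h.setLIntegral_historyEvent ht hg0 hg (n - 1) 0 ω₁ (by omega),
      h.policy_eq ht.le hω₁, mul_comm]
    exact mul_le_mul_left (ENNReal.ofReal_le_ofReal (hc _)) _

/-- Plays the role of conditioning on the past: finitely many pasts are possible, and on each of
them `F` and the policy are constant and can be pulled out. -/
lemma IsRun.lintegral_mul_le (h : IsRun M W η θ n k π₀ ℙ Z π) (hn : 0 < n) {t : ℕ}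
    (ht : t < k) {g : Policy S A → (ℕ → S × A) → ℝ} (hg0 : ∀ p y, 0 ≤ g p y)
    (hg : ∀ p, ∀ x y : ℕ → S × A, (∀ l < n, x l = y l) → g p x = g p y) {c : ℝ}
    (hc : ∀ p x, pathExp (M.pairTrans p) (g p) (n - 1) 0 x ≤ c) {F : Ω → ENNReal}
    (hF : ∀ ω, F ω ≠ ⊤) (hFp : ∀ ω₀, ∀ ω ∈ pastEvent Z n t ω₀, F ω = F ω₀) :
    ∫⁻ ω, F ω * ENNReal.ofReal (g (π t ω) fun l => Z t l ω) ∂ℙ ≤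
      ENNReal.ofReal c * ∫⁻ ω, F ω ∂ℙ := by
  have hfib := h.measurableSet_past_fiber ht.le
  rw [← setLIntegral_univ, ← setLIntegral_univ F,
    setLIntegral_eq_sum_fiber ℙ MeasurableSet.univ _ hfib,
    setLIntegral_eq_sum_fiber ℙ MeasurableSet.univ _ hfib, Finset.mul_sum]
  refine Finset.sum_le_sum fun b _ => ?_
  rw [Set.univ_inter]
  rcases Set.eq_empty_or_nonempty {ω | (fun (i : Fin t) (l : Fin n) => Z i l ω) = b} with
    he | ⟨ω₀, rfl⟩
  · rw [he]; simp
  · rw [past_fiber_eq]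
    have hm := h.measurableSet_pastEvent ht.le ω₀
    rw [setLIntegral_congr_fun (g := fun ω => F ω₀ *
        ENNReal.ofReal (g (π t ω₀) fun l => Z t l ω)) hm, lintegral_const_mul' _ _ (hF ω₀),
      setLIntegral_congr_fun (f := F) (g := fun _ => F ω₀) hm fun ω hω => hFp ω₀ ω hω,
      setLIntegral_const, mul_left_comm]
    · exact mul_le_mul_right (h.setLIntegral_pastEvent_le hn ht (hg0 _) (hg _) ω₀ (hc _)) _
    · intro ω hω
      simp only
      rw [hFp ω₀ ω hω, h.policy_eq ht.le hω]

variable [IsProbabilityMeasure ℙ]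

/-- The last iteration is peeled off: all earlier summands are determined by the past, and the last
factor has conditional mean at most `exp c`. -/
lemma IsRun.lintegral_exp_sum_le (h : IsRun M W η θ n k π₀ ℙ Z π) (hn : 0 < n)
    {g : Policy S A → (ℕ → S × A) → ℝ}
    (hg : ∀ p, ∀ x y : ℕ → S × A, (∀ l < n, x l = y l) → g p x = g p y) {c lam : ℝ}
    (hc : ∀ p x, pathExp (M.pairTrans p) (fun y => Real.exp (lam * g p y)) (n - 1) 0 x ≤
      Real.exp c) {j : ℕ} (hj : j ≤ k) :
    ∫⁻ ω, ENNReal.ofReal (Real.exp (lam * ∑ t ∈ Finset.range j, g (π t ω) fun l => Z t l ω)) ∂ℙ ≤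
      ENNReal.ofReal (Real.exp (j * c)) := by
  induction j with
  | zero => simp
  | succ j ih =>
    have hs : ∀ ω, ENNReal.ofReal (Real.exp (lam * ∑ t ∈ Finset.range (j + 1),
        g (π t ω) fun l => Z t l ω)) =
        ENNReal.ofReal (Real.exp (lam * ∑ t ∈ Finset.range j, g (π t ω) fun l => Z t l ω)) *
          ENNReal.ofReal (Real.exp (lam * g (π j ω) fun l => Z j l ω)) := fun ω => by
      rw [← ENNReal.ofReal_mul (Real.exp_pos _).le, ← Real.exp_add, Finset.sum_range_succ, mul_add]
    simp only [hs]
    refine (h.lintegral_mul_le hn (t := j) (by omega)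
      (g := fun p y => Real.exp (lam * g p y)) (fun _ _ => (Real.exp_pos _).le)
      (fun p x y hxy => by rw [hg p x y hxy]) hc (fun _ => ENNReal.ofReal_ne_top) ?_).trans ?_
    · intro ω₀ ω hω
      congr 3
      refine Finset.sum_congr rfl fun t ht => ?_
      have ht := Finset.mem_range.1 ht
      rw [h.policy_eq (t := t) (by omega) fun i hi => hω i (by omega)]
      exact hg _ _ _ (hω t ht)
    · refine (mul_le_mul_right (ih (by omega)) _).trans_eq ?_
      rw [← ENNReal.ofReal_mul (Real.exp_pos _).le, ← Real.exp_add]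
      congr 2
      push_cast
      ring

/-- A Chernoff bound for sums of functions of the policies and trajectories. -/
lemma IsRun.measure_sum_gt_le (h : IsRun M W η θ n k π₀ ℙ Z π) (hn : 0 < n)
    {g : Policy S A → (ℕ → S × A) → ℝ}
    (hg : ∀ p, ∀ x y : ℕ → S × A, (∀ l < n, x l = y l) → g p x = g p y) {c lam : ℝ}
    (hlam : 0 ≤ lam)
    (hc : ∀ p x, pathExp (M.pairTrans p) (fun y => Real.exp (lam * g p y)) (n - 1) 0 x ≤
      Real.exp c) {j : ℕ} (hj : j ≤ k) (b : ℝ) :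
    ℙ {ω | b < ∑ t ∈ Finset.range j, g (π t ω) fun l => Z t l ω} ≤
      ENNReal.ofReal (Real.exp (j * c - lam * b)) := by
  set U := {ω | b < ∑ t ∈ Finset.range j, g (π t ω) fun l => Z t l ω} with hU
  -- Policies are not assumed measurable; the event is measurable because it is determined by the
  -- first `j` trajectories.
  have hm : MeasurableSet U := by
    refine h.measurableSet_of_past hj fun ω₀ hω₀ ω hω => ?_
    have : ∑ t ∈ Finset.range j, g (π t ω) (fun l => Z t l ω) =
        ∑ t ∈ Finset.range j, g (π t ω₀) (fun l => Z t l ω₀) := by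
      refine Finset.sum_congr rfl fun t ht => ?_
      have ht := Finset.mem_range.1 ht
      rw [h.policy_eq (t := t) (by omega) fun i hi => hω i (by omega)]
      exact hg _ _ _ (hω t ht)
    simp only [hU, Set.mem_ofPred_eq] at hω₀ ⊢
    rwa [this]
  have h1 : ENNReal.ofReal (Real.exp (lam * b)) * ℙ U ≤ ENNReal.ofReal (Real.exp (j * c)) := by
    rw [← setLIntegral_const]
    refine (setLIntegral_mono' hm fun ω hω => ?_).trans
      ((setLIntegral_le_lintegral U _).trans (h.lintegral_exp_sum_le hn hg hc hj))
    exact ENNReal.ofReal_le_ofReal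
      (Real.exp_le_exp.2 (mul_le_mul_of_nonneg_left (le_of_lt hω) hlam))
  have h2 : ℙ U = ENNReal.ofReal (Real.exp (-(lam * b))) *
      (ENNReal.ofReal (Real.exp (lam * b)) * ℙ U) := by
    rw [← mul_assoc, ← ENNReal.ofReal_mul (Real.exp_pos _).le, ← Real.exp_add, neg_add_cancel,
      Real.exp_zero, ENNReal.ofReal_one, one_mul]
  rw [h2]
  refine (mul_le_mul_right h1 _).trans_eq ?_
  rw [← ENNReal.ofReal_mul (Real.exp_pos _).le, ← Real.exp_add]
  congr 2
  ring

end Run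

/-! ### The weighted estimation error -/

section Noise

variable {S A : Type*} [Fintype S] [DecidableEq S] [Fintype A]

lemma pathExp_const_sub {X : Type*} [Fintype X] {K : X → X → ℝ} (hK : IsStochastic K) (c : ℝ)
    (g : (ℕ → X) → ℝ) (m j : ℕ) (x : ℕ → X) :
    pathExp K (fun y => c - g y) m j x = c - pathExp K g m j x := by
  have h1 : ∀ y, c - g y = c + (-1) * g y := fun y => by ring
  simp only [h1, pathExp_add, pathExp_const_mul, pathExp_const hK]
  ring

lemma sum_mul_mem_Icc {p : A → ℝ} (hp : p ∈ stdSimplex ℝ A) {q : A → ℝ} {G : ℝ}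
    (hq : ∀ a, q a ∈ Set.Icc 0 G) : ∑ a, p a * q a ∈ Set.Icc 0 G := by
  refine ⟨Finset.sum_nonneg fun a _ => mul_nonneg (hp.1 a) (hq a).1, ?_⟩
  calc ∑ a, p a * q a ≤ ∑ a, p a * G :=
        Finset.sum_le_sum fun a _ => mul_le_mul_of_nonneg_left (hq a).2 (hp.1 a)
    _ = G := by rw [← Finset.sum_mul, hp.2, one_mul]

lemma abs_sum_sub_mul_le {p p' : A → ℝ} (hp : p ∈ stdSimplex ℝ A) (hp' : p' ∈ stdSimplex ℝ A)
    {q : A → ℝ} {G : ℝ} (hq : ∀ a, q a ∈ Set.Icc 0 G) : |∑ a, (p a - p' a) * q a| ≤ G := by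
  simp only [sub_mul, Finset.sum_sub_distrib]
  obtain ⟨h1, h2⟩ := sum_mul_mem_Icc hp hq
  obtain ⟨h3, h4⟩ := sum_mul_mem_Icc hp' hq
  rw [abs_le]
  constructor <;> linarith

/-- The normalized discounted occupancy measure of `πs` started at `s`. -/
def MDP.weight (M : MDP S A) (πs : Policy S A) (s s' : S) : ℝ :=
  (1 - M.γ) * M.occupancy πs s s'

lemma MDP.weight_nonneg (M : MDP S A) (πs : Policy S A) (s s' : S) : 0 ≤ M.weight πs s s' :=
  mul_nonneg M.one_sub_γ_pos.le (M.occupancy_nonneg πs s s')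

lemma MDP.weight_sum (M : MDP S A) (πs : Policy S A) (s : S) : ∑ s', M.weight πs s s' = 1 := by
  simp only [MDP.weight, ← Finset.mul_sum, M.occupancy_sum]

lemma MDP.le_weight_self (M : MDP S A) (πs : Policy S A) (s : S) : 1 - M.γ ≤ M.weight πs s s :=
  le_mul_of_one_le_right M.one_sub_γ_pos.le (M.one_le_occupancy_self πs s)

lemma MDP.sum_weight_mul_le (M : MDP S A) (πs : Policy S A) (s : S) {f : S → ℝ} {b : ℝ}
    (h : ∀ s', f s' ≤ b) : ∑ s', M.weight πs s s' * f s' ≤ b := by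
  calc _ ≤ ∑ s', M.weight πs s s' * b :=
        Finset.sum_le_sum fun s' _ => mul_le_mul_of_nonneg_left (h s') (M.weight_nonneg πs s s')
    _ = b := by rw [← Finset.sum_mul, M.weight_sum, one_mul]

lemma MDP.value_gap_eq (M : MDP S A) (π πs : Policy S A) (s : S) :
    (1 - M.γ) * (M.value π s - M.value πs s) = ∑ s', M.weight πs s s' *
      ∑ a, ((π s').1 a - (πs s').1 a) * M.qvalue π (s', a) := by
  rw [M.value_sub_value, Finset.mul_sum]
  simp only [MDP.weight, mul_assoc]

/-- Policies that mix and give every action selected by `f` probability at least `θ`. -/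
def MDP.IsGood (M : MDP S A) (f : S → A) (C ρ νmin θ : ℝ) (p : Policy S A) : Prop :=
  (∀ s, θ ≤ (p s).1 (f s)) ∧ M.MixesWith p C ρ νmin

open Classical in
/-- The weighted estimation error at a good policy. -/
def MDP.noise (M : MDP S A) (πs : Policy S A) (f : S → A) (C ρ νmin θ : ℝ) (n : ℕ) (s : S)
    (p : Policy S A) (x : ℕ → S × A) : ℝ :=
  if M.IsGood f C ρ νmin θ p then ∑ s', M.weight πs s s' *
    ∑ a, ((p s').1 a - (πs s').1 a) * (M.qvalue p (s', a) - M.tomc n θ p x s' a) else 0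

variable {M : MDP S A} {πs : Policy S A} {f : S → A} {C ρ νmin θ : ℝ} {n : ℕ}

lemma MDP.noise_congr (s : S) (p : Policy S A) (x y : ℕ → S × A) (h : ∀ l < n, x l = y l) :
    M.noise πs f C ρ νmin θ n s p x = M.noise πs f C ρ νmin θ n s p y := by
  unfold MDP.noise
  rw [M.tomc_congr θ p h]

/-- By performance difference, the noise is the true gap minus the linear term seen by mirror
descent, the form needed to insert it into the descent inequality. -/
lemma MDP.noise_eq {p : Policy S A} (hp : M.IsGood f C ρ νmin θ p) (s : S) (x : ℕ → S × A) :
    M.noise πs f C ρ νmin θ n s p x = (1 - M.γ) * (M.value p s - M.value πs s) -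
      ∑ s', M.weight πs s s' * ∑ a, ((p s').1 a - (πs s').1 a) * M.tomc n θ p x s' a := by
  rw [MDP.noise, if_pos hp, M.value_gap_eq, ← Finset.sum_sub_distrib]
  refine Finset.sum_congr rfl fun s' _ => ?_
  rw [← mul_sub, ← Finset.sum_sub_distrib]
  simp only [mul_sub]

/-- The part involving the true `Q` does not depend on the trajectory and serves as the centre; the
rest is an average of differences of two means of values in `[0, 1 / (1 - γ)]`. -/
lemma MDP.exists_abs_noise_sub_le (s : S) (p : Policy S A) :
    ∃ c₀, ∀ x, |M.noise πs f C ρ νmin θ n s p x - c₀| ≤ 1 / (1 - M.γ) := by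
  by_cases hp : M.IsGood f C ρ νmin θ p
  · refine ⟨(1 - M.γ) * (M.value p s - M.value πs s), fun x => ?_⟩
    rw [MDP.noise_eq hp, sub_sub_cancel_left, abs_neg]
    refine (Finset.abs_sum_le_sum_abs _ _).trans ?_
    simp only [abs_mul, abs_of_nonneg (M.weight_nonneg πs s _)]
    exact M.sum_weight_mul_le πs s fun s' =>
      abs_sum_sub_mul_le (p s').2 (πs s').2 fun a => M.tomc_mem n θ p x s' a
  · refine ⟨0, fun x => ?_⟩
    rw [MDP.noise, if_neg hp, sub_zero, abs_zero]
    exact (one_div_pos.2 M.one_sub_γ_pos).le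

variable [Nonempty A]

/-- All bias comes from actions that `p` takes with probability at least `θ`, and is at most `ε / 2`
by mixing. Truncated actions have `Q` minus estimate nonpositive. The term of `πs` sees only the
untruncated action `f s'` and enters with a minus sign, where the underestimation of `Q` helps. -/
lemma MDP.pathExp_noise_le {ε : ℝ} (hC : 0 < C) (hρ : 0 < ρ) (hρ1 : ρ < 1) (hν : 0 < νmin)
    (hθ : 0 < θ) (hθ1 : θ ≤ 1) (hε : 0 < ε) (hf : ∀ s, (πs s).1 (f s) = 1)
    (hn : 10 * M.lengthOrder C ρ νmin θ ε ≤ n) (s : S) (p : Policy S A) (x : ℕ → S × A) :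
    pathExp (M.pairTrans p) (M.noise πs f C ρ νmin θ n s p) (n - 1) 0 x ≤ ε / 2 := by
  classical
  have hK := M.pairTrans_isStochastic p
  by_cases hp : M.IsGood f C ρ νmin θ p
  swap
  · refine pathExp_le hK (fun y => ?_) _ _ _
    rw [MDP.noise, if_neg hp]
    linarith
  have hbias : ∀ s' a, θ ≤ (p s').1 a →
      pathExp (M.pairTrans p) (fun y => M.qvalue p (s', a) - M.omc n y (s', a)) (n - 1) 0 x ∈
        Set.Icc 0 (ε / 2) := fun s' a ha => by
    rw [pathExp_const_sub hK]
    exact M.bias_mem hC hρ hρ1 hν hθ hθ1 hε hp.2 hn ha x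
  -- The nonpositive error of a truncated action is replaced by zero.
  let φ : S → A → (ℕ → S × A) → ℝ := fun s' a y =>
    if θ ≤ (p s').1 a then M.qvalue p (s', a) - M.omc n y (s', a) else 0
  have hφ : ∀ s' a, pathExp (M.pairTrans p) (φ s' a) (n - 1) 0 x ≤ ε / 2 := fun s' a => by
    by_cases ha : θ ≤ (p s').1 a
    · simp only [φ, if_pos ha]
      exact (hbias s' a ha).2
    · simp only [φ, if_neg ha]
      rw [pathExp_const hK]
      linarith
  have hle : ∀ y, M.noise πs f C ρ νmin θ n s p y ≤ ∑ s', M.weight πs s s' *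
      (∑ a, (p s').1 a * φ s' a y +
        (-1) * (M.qvalue p (s', f s') - M.omc n y (s', f s'))) := fun y => by
    rw [MDP.noise, if_pos hp]
    refine Finset.sum_le_sum fun s' _ =>
      mul_le_mul_of_nonneg_left ?_ (M.weight_nonneg πs s s')
    simp only [sub_mul _ _ (_ - _), Finset.sum_sub_distrib (fun _ => _ * (_ - _))]
    rw [sum_mul_of_apply_eq_one (πs s').2 (hf s')
      fun a => M.qvalue p (s', a) - M.tomc n θ p y s' a]
    have h1 : M.tomc n θ p y s' (f s') = M.omc n y (s', f s') := if_pos (hp.1 s')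
    have h2 : ∑ a, (p s').1 a * (M.qvalue p (s', a) - M.tomc n θ p y s' a) ≤
        ∑ a, (p s').1 a * φ s' a y := Finset.sum_le_sum fun a _ => by
      refine mul_le_mul_of_nonneg_left ?_ ((p s').2.1 a)
      by_cases ha : θ ≤ (p s').1 a
      · simp only [φ, MDP.tomc, if_pos ha, le_refl]
      · simp only [φ, MDP.tomc, if_neg ha]
        linarith [M.qvalue_le p (s', a)]
    rw [h1]
    linarith
  refine (pathExp_mono hK _ _ _ fun y _ => hle y).trans ?_
  simp only [pathExp_sum, pathExp_const_mul, pathExp_add]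
  refine M.sum_weight_mul_le πs s fun s' => ?_
  have h1 : ∑ a, (p s').1 a * pathExp (M.pairTrans p) (φ s' a) (n - 1) 0 x ≤ ε / 2 := by
    calc _ ≤ ∑ a, (p s').1 a * (ε / 2) :=
          Finset.sum_le_sum fun a _ => mul_le_mul_of_nonneg_left (hφ s' a) ((p s').2.1 a)
      _ = ε / 2 := by rw [← Finset.sum_mul, (p s').2.2, one_mul]
  have h2 := (hbias s' (f s') (hp.1 s')).1
  linarith

end Noise

/-! ### Chernoff bound for the accumulated noise -/

section Concentration

variable {S A : Type*} [Fintype S] [DecidableEq S] [Nonempty S] [Fintype A] [Nonempty A]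
  {M : MDP S A} {W : DistGen A} {η θ : ℝ} {n k : ℕ} {π₀ : Policy S A}
  {Ω : Type*} [MeasurableSpace Ω] {ℙ : Measure Ω} [IsProbabilityMeasure ℙ]
  {Z : ℕ → ℕ → Ω → S × A} {π : ℕ → Ω → Policy S A}

lemma one_lt_card_mul_div (S : Type*) [Fintype S] [Nonempty S] {k : ℕ} (hk : 0 < k) {δ : ℝ}
    (hδ : 0 < δ) (hδ1 : δ < 1) : 1 < Fintype.card S * k / δ := by
  rw [lt_div_iff₀ hδ, one_mul]
  have h1 : (1 : ℝ) ≤ Fintype.card S := by exact_mod_cast Fintype.card_pos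
  have h2 : (1 : ℝ) ≤ k := by exact_mod_cast hk
  nlinarith

lemma MDP.epsPar_pos (M : MDP S A) (hk : 0 < k) {δ : ℝ} (hδ : 0 < δ) (hδ1 : δ < 1) :
    0 < M.epsPar k δ := by
  have := Real.log_pos (one_lt_card_mul_div S hk hδ hδ1)
  have := M.one_sub_γ_pos
  have : (0 : ℝ) < k := by exact_mod_cast hk
  unfold MDP.epsPar
  positivity

/-- The explicit lower bound serves to absorb the rounding of `n` into a constant factor. -/
lemma MDP.lengthOrder_pos (M : MDP S A) {C ρ νmin ε : ℝ} (hν : 0 < νmin)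
    (hθ : 0 < θ) (hε : 0 < ε) : 1 / 2 ≤ M.lengthOrder C ρ νmin θ ε := by
  have h1 : 1 ≤ M.horizon C ρ νmin θ := by
    have : 1 ≤ 1 / (1 - M.γ) := by
      rw [le_div_iff₀ M.one_sub_γ_pos]; linarith [M.γ_pos]
    have : (0 : ℝ) ≤ (max 1 ⌈Real.logb ρ (νmin * θ / (2 * C))⌉₊ : ℕ) / (νmin * θ) := by positivity
    unfold MDP.horizon
    linarith
  have h2 : 1 / 2 ≤ Real.log (2 + M.horizon C ρ νmin θ * Fintype.card A / ε) := by
    have h3 := Real.log_two_gt_d9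
    have h4 : Real.log 2 ≤ Real.log (2 + M.horizon C ρ νmin θ * Fintype.card A / ε) :=
      Real.log_le_log two_pos (by
        have : 0 ≤ M.horizon C ρ νmin θ * Fintype.card A / ε := by positivity
        linarith)
    linarith
  unfold MDP.lengthOrder
  nlinarith

lemma IsRun.measure_noise_gt_le (h : IsRun M W η θ n k π₀ ℙ Z π) {C ρ νmin δ : ℝ}
    (hC : 0 < C) (hρ : 0 < ρ) (hρ1 : ρ < 1) (hν : 0 < νmin) (hθ : 0 < θ) (hθ1 : θ ≤ 1)
    (hk : 0 < k) (hδ : 0 < δ) (hδ1 : δ < 1) {πs : Policy S A} {f : S → A}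
    (hf : ∀ s, (πs s).1 (f s) = 1)
    (hn : 10 * M.lengthOrder C ρ νmin θ (M.epsPar k δ) ≤ n) (s : S) {j : ℕ} (hj : j ≤ k) :
    ℙ {ω | M.Zpar k δ * √k < ∑ t ∈ Finset.range j,
      M.noise πs f C ρ νmin θ n s (π t ω) fun l => Z t l ω} ≤
      ENNReal.ofReal (δ / (Fintype.card S * k)) := by
  have hk' : (0 : ℝ) < k := by exact_mod_cast hk
  have hy := one_lt_card_mul_div S hk hδ hδ1
  have hl := Real.log_pos hy
  have hε := M.epsPar_pos hk hδ hδ1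
  have hn0 : 0 < n := by
    have := M.lengthOrder_pos (C := C) (ρ := ρ) hν hθ hε
    have : (0 : ℝ) < n := by linarith
    exact_mod_cast this
  set l := Real.log (Fintype.card S * k / δ) with hldef
  set G := 1 / (1 - M.γ) with hG
  have hG0 : 0 < G := one_div_pos.2 M.one_sub_γ_pos
  set r := √(l / k) with hr
  have hr0 : 0 < r := Real.sqrt_pos.2 (by positivity)
  have hr2 : r ^ 2 * k = l := by rw [hr, Real.sq_sqrt (by positivity)]; field_simp
  have heps : M.epsPar k δ / 2 = G * r := by
    simp only [MDP.epsPar, ← hldef, ← hr, hG]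
    ring
  have hZ : M.Zpar k δ * √k = 4 * G * r * k := by
    have h1 : √l = r * √k := by
      rw [hr, ← Real.sqrt_mul (by positivity)]
      congr 1
      field_simp
    have h2 : √(k : ℝ) * √k = k := Real.mul_self_sqrt hk'.le
    simp only [MDP.Zpar, ← hldef, h1, hG]
    linear_combination 4 * r / (1 - M.γ) * h2
  -- With `lam = a * r / G` and `j = k` the Chernoff exponent is `(2 * a ^ 2 - 3 * a) * l`, minimal
  -- at `a = 3 / 4` with value `-(9 / 8) * l`, which is below the required `-l`.
  set lam := 3 * r / (4 * G) with hlam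
  have hlam0 : 0 < lam := by positivity
  have hc : ∀ p x, pathExp (M.pairTrans p) (fun y => Real.exp (lam *
      M.noise πs f C ρ νmin θ n s p y)) (n - 1) 0 x ≤
      Real.exp (lam * (M.epsPar k δ / 2) + 2 * lam ^ 2 * G ^ 2) := fun p x => by
    obtain ⟨c₀, hc₀⟩ := MDP.exists_abs_noise_sub_le (M := M) (πs := πs) (f := f) (C := C) (ρ := ρ)
      (νmin := νmin) (θ := θ) (n := n) s p
    exact pathExp_exp_le (M.pairTrans_isStochastic p) hG0 hlam0 _ _ _ hc₀
      (MDP.pathExp_noise_le hC hρ hρ1 hν hθ hθ1 hε hf hn s p x)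
  refine (h.measure_sum_gt_le hn0 (MDP.noise_congr s) hlam0.le hc hj _).trans ?_
  refine ENNReal.ofReal_le_ofReal ?_
  have hexp : Real.exp (-l) = δ / (Fintype.card S * k) := by
    rw [Real.exp_neg, hldef, Real.exp_log (by linarith), inv_div]
  rw [← hexp, Real.exp_le_exp, heps, hZ]
  have hlG : lam * G = 3 * r / 4 := by rw [hlam]; field_simp
  have e1 : lam * (G * r) + 2 * lam ^ 2 * G ^ 2 = 15 / 8 * r ^ 2 := by
    linear_combination (r + 2 * (lam * G) + 3 * r / 2) * hlG
  have e2 : lam * (4 * G * r * k) = 3 * l := by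
    linear_combination 4 * r * k * hlG + 3 * hr2
  have hjk : (j : ℝ) ≤ k := by exact_mod_cast hj
  rw [e1, e2]
  have : (j : ℝ) * (15 / 8 * r ^ 2) ≤ k * (15 / 8 * r ^ 2) :=
    mul_le_mul_of_nonneg_right hjk (by positivity)
  nlinarith

end Concentration

/-! ### Descent of the potential, bootstrap of good policies, optimality gap -/

section Regret

variable {S A : Type*} [Fintype S] [DecidableEq S] [Nonempty S] [Fintype A] [Nonempty A]
  {M : MDP S A} {W : DistGen A} {η θ : ℝ} {n k : ℕ} {π₀ : Policy S A}
  {Ω : Type*} [MeasurableSpace Ω] {ℙ : Measure Ω}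
  {Z : ℕ → ℕ → Ω → S × A} {π : ℕ → Ω → Policy S A}

/-- The weighted divergence to `πs` decreases up to the noise along good policies. -/
lemma IsRun.potential_step (h : IsRun M W η θ n k π₀ ℙ Z π) {μ : ℝ} {τ : ℝ → ℝ}
    (hD : DivergenceCondition M W μ τ) (hη : 0 ≤ η) (hπ₀ : π₀.IsInterior) {πs : Policy S A}
    {f : S → A} {C ρ νmin : ℝ} {t : ℕ} (ht : t < k) (ω : Ω)
    (hgood : M.IsGood f C ρ νmin θ (π t ω)) (s : S) :
    η * ((1 - M.γ) * (M.value (π t ω) s - M.value πs s) -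
        M.noise πs f C ρ νmin θ n s (π t ω) fun l => Z t l ω) +
      ∑ s', M.weight πs s s' * W.bregman (πs s').1 (π (t + 1) ω s').1 ≤
      ∑ s', M.weight πs s s' * W.bregman (πs s').1 (π t ω s').1 +
        (η * (1 / (1 - M.γ))) ^ 2 / (2 * μ) := by
  have hstep : ∀ s', η * ∑ a, ((π t ω s').1 a - (πs s').1 a) *
      M.tomc n θ (π t ω) (fun l => Z t l ω) s' a + W.bregman (πs s').1 (π (t + 1) ω s').1 ≤
      W.bregman (πs s').1 (π t ω s').1 + (η * (1 / (1 - M.γ))) ^ 2 / (2 * μ) := fun s' => by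
    have h1 := hD.step_le hη (G := 1 / (1 - M.γ)) (fun a => by
      obtain ⟨h2, h3⟩ := M.tomc_mem n θ (π t ω) (fun l => Z t l ω) s' a
      rwa [abs_of_nonneg h2]) (h.isInterior hD hη hπ₀ ht.le ω s') (h.update t ht ω s') (πs s').2
    simpa only [mul_comm (M.tomc _ _ _ _ _ _)] using h1
  rw [MDP.noise_eq hgood, sub_sub_cancel]
  calc _ = ∑ s', M.weight πs s s' * (η * ∑ a, ((π t ω s').1 a - (πs s').1 a) *
        M.tomc n θ (π t ω) (fun l => Z t l ω) s' a + W.bregman (πs s').1 (π (t + 1) ω s').1) := by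
        simp only [mul_add, Finset.sum_add_distrib, mul_left_comm _ η, ← Finset.mul_sum]
    _ ≤ ∑ s', M.weight πs s s' * (W.bregman (πs s').1 (π t ω s').1 +
        (η * (1 / (1 - M.γ))) ^ 2 / (2 * μ)) := Finset.sum_le_sum fun s' _ =>
          mul_le_mul_of_nonneg_left (hstep s') (M.weight_nonneg πs s s')
    _ = _ := by
        simp only [mul_add, Finset.sum_add_distrib, ← Finset.sum_mul, M.weight_sum, one_mul]

lemma IsRun.potential_le (h : IsRun M W η θ n k π₀ ℙ Z π) {μ : ℝ} {τ : ℝ → ℝ}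
    (hD : DivergenceCondition M W μ τ) (hη : 0 ≤ η) (hπ₀ : π₀.IsInterior) {πs : Policy S A}
    {f : S → A} {C ρ νmin : ℝ} (ω : Ω) (s : S) {j : ℕ} (hj : j ≤ k)
    (hgood : ∀ t < j, M.IsGood f C ρ νmin θ (π t ω)) :
    η * (1 - M.γ) * ∑ t ∈ Finset.range j, (M.value (π t ω) s - M.value πs s) +
      ∑ s', M.weight πs s s' * W.bregman (πs s').1 (π j ω s').1 ≤
      ∑ s', M.weight πs s s' * W.bregman (πs s').1 (π₀ s').1 +
        j * ((η * (1 / (1 - M.γ))) ^ 2 / (2 * μ)) +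
        η * ∑ t ∈ Finset.range j, M.noise πs f C ρ νmin θ n s (π t ω) fun l => Z t l ω := by
  induction j with
  | zero => simp [h.init]
  | succ j ih =>
    have h1 := ih (by omega) fun t ht => hgood t (by omega)
    have h2 := h.potential_step hD hη hπ₀ (πs := πs) (t := j) (by omega) ω
      (hgood j (by omega)) s
    rw [Finset.sum_range_succ, Finset.sum_range_succ]
    push_cast
    linarith

/-- On the event that the accumulated noise stays below `Zp * √k`, all policies are good and the
regret is bounded. -/
lemma IsRun.regret_le {μ : ℝ} {τ : ℝ → ℝ} {D Zp : ℝ}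
    (h : IsRun M W (M.zeta μ D Zp / √k) (threshold A τ D) n k π₀ ℙ Z π)
    (hD : DivergenceCondition M W μ τ) (hk : 0 < k) (hD0 : 0 < D) (hZ : 0 ≤ Zp)
    (hπ₀ : π₀.IsInterior) {πs : Policy S A} {f : S → A} (hf : ∀ s, (πs s).1 (f s) = 1)
    (hopt : M.IsOptimal πs) (hDπ : ∀ s, (2 + Zp) * W.bregman (πs s).1 (π₀ s).1 ≤ D)
    {C ρ νmin : ℝ} (ω : Ω) (hmix : ∀ t < k, M.MixesWith (π t ω) C ρ νmin)
    (hnoise : ∀ s, ∀ j < k, ∑ t ∈ Finset.range (j + 1),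
      M.noise πs f C ρ νmin (threshold A τ D) n s (π t ω) (fun l => Z t l ω) ≤ Zp * √k) (s : S) :
    ∑ t ∈ Finset.range k, (M.value (π t ω) s - M.value πs s) ≤ k * M.gapBound μ D Zp k := by
  have hμ := hD.mu_pos
  have hg := M.one_sub_γ_pos
  have hk' : (0 : ℝ) < k := by exact_mod_cast hk
  have hsk : 0 < √(k : ℝ) := Real.sqrt_pos.2 hk'
  have hsk2 : √(k : ℝ) * √k = k := Real.mul_self_sqrt hk'.le
  have hZ2 : 0 < 2 + Zp := by linarith
  set ζ := M.zeta μ D Zp with hζdef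
  have hζ0 : 0 < ζ := by
    rw [hζdef, MDP.zeta]
    exact lt_min (Real.sqrt_pos.2 (by positivity)) (by positivity)
  have hζ1 : ζ ≤ D / (2 + Zp) := min_le_right _ _
  -- The two terms of the minimum defining `ζ` have different tasks: the square root controls the
  -- quadratic stepsize terms, the quotient `D / (2 + Zp)` controls the noise.
  have hζ2 : (ζ * (1 / (1 - M.γ))) ^ 2 / (2 * μ) ≤ D / (2 + Zp) := by
    have h1 : ζ ^ 2 ≤ 2 * D * μ / ((2 + Zp) * (1 / (1 - M.γ)) ^ 2) := by
      have h2 : ζ ≤ √(2 * D * μ / ((2 + Zp) * (1 / (1 - M.γ)) ^ 2)) := min_le_left _ _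
      calc ζ ^ 2 ≤ √(2 * D * μ / ((2 + Zp) * (1 / (1 - M.γ)) ^ 2)) ^ 2 :=
            pow_le_pow_left₀ hζ0.le h2 2
        _ = _ := Real.sq_sqrt (by positivity)
    rw [mul_pow, div_le_iff₀ (by positivity)]
    rw [le_div_iff₀ (by positivity)] at h1
    rw [div_mul_eq_mul_div, le_div_iff₀ hZ2]
    linarith
  set η := ζ / √k with hη
  have hη0 : 0 < η := by positivity
  have hηk : η * √k = ζ := by rw [hη]; field_simp
  have hbreg : ∀ t ≤ k, ∀ s, 0 ≤ W.bregman (πs s).1 (π t ω s).1 := fun t ht s =>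
    hD.bregman_nonneg (πs s).2 (h.isInterior hD hη0.le hπ₀ ht ω s)
  have hinit : ∀ s, ∑ s', M.weight πs s s' * W.bregman (πs s').1 (π₀ s').1 ≤ D / (2 + Zp) :=
    fun s => M.sum_weight_mul_le πs s fun s' => by
      rw [le_div_iff₀' hZ2]; exact hDπ s'
  have hnoise' : ∀ s, ∀ j ≤ k, ∑ t ∈ Finset.range j,
      M.noise πs f C ρ νmin (threshold A τ D) n s (π t ω) (fun l => Z t l ω) ≤ Zp * √k := by
    intro s j hj
    cases j with
    | zero => simpa using mul_nonneg hZ hsk.le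
    | succ j => exact hnoise s j (by omega)
  have hbound : ∀ s, ∀ j ≤ k, (∀ t < j, M.IsGood f C ρ νmin (threshold A τ D) (π t ω)) →
      η * (1 - M.γ) * ∑ t ∈ Finset.range j, (M.value (π t ω) s - M.value πs s) +
        ∑ s', M.weight πs s s' * W.bregman (πs s').1 (π j ω s').1 ≤
        D / (2 + Zp) + (ζ * (1 / (1 - M.γ))) ^ 2 / (2 * μ) + ζ * Zp := by
    intro s j hj hgood
    have h1 := h.potential_le hD hη0.le hπ₀ (πs := πs) ω s hj hgood
    have h2 : (j : ℝ) * ((η * (1 / (1 - M.γ))) ^ 2 / (2 * μ)) ≤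
        (ζ * (1 / (1 - M.γ))) ^ 2 / (2 * μ) := by
      have hjk : (j : ℝ) ≤ k := by exact_mod_cast hj
      calc _ ≤ (k : ℝ) * ((η * (1 / (1 - M.γ))) ^ 2 / (2 * μ)) :=
            mul_le_mul_of_nonneg_right hjk (by positivity)
        _ = _ := by rw [← hηk]; linear_combination -(η * (1 / (1 - M.γ))) ^ 2 / (2 * μ) * hsk2
    have h3 := mul_le_mul_of_nonneg_left (hnoise' s j hj) hη0.le
    have h4 : η * (Zp * √k) = ζ * Zp := by rw [← hηk]; ring
    linarith [hinit s]
  -- The bootstrap: goodness before time `t` bounds the potential at time `t` by `D`, and `tau_le`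
  -- turns this into goodness at time `t`. Optimality of `πs` allows the regret term to be dropped.
  have hgood : ∀ t, t < k → M.IsGood f C ρ νmin (threshold A τ D) (π t ω) := by
    intro t
    induction t using Nat.strong_induction_on with
    | _ t ih =>
      intro ht
      refine ⟨fun s => (min_le_left _ _).trans (hD.tau_le D hD0 s (π t ω) πs (f s)
        (h.isInterior hD hη0.le hπ₀ ht.le ω) hopt (fun s => ⟨f s, hf s⟩) (hf s) ?_), hmix t ht⟩
      have h1 := hbound s t ht.le fun i hi => ih i hi (by omega)
      have h2 : 0 ≤ η * (1 - M.γ) * ∑ t ∈ Finset.range t, (M.value (π t ω) s - M.value πs s) :=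
        mul_nonneg (by positivity) (Finset.sum_nonneg fun i _ => sub_nonneg.2 (hopt _ s))
      -- The occupancy started at `s` gives `s` weight at least `1 - γ`, so the averaged potential
      -- controls the divergence at that single state; hence the factor `1 - γ` in condition (3).
      have h3 : (1 - M.γ) * W.bregman (πs s).1 (π t ω s).1 ≤
          ∑ s', M.weight πs s s' * W.bregman (πs s').1 (π t ω s').1 :=
        (mul_le_mul_of_nonneg_right (M.le_weight_self πs s) (hbreg t ht.le s)).trans
          (Finset.single_le_sum (f := fun s' => M.weight πs s s' *
            W.bregman (πs s').1 (π t ω s').1) (fun s' _ => mul_nonneg (M.weight_nonneg πs s s')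
              (hbreg t ht.le s')) (Finset.mem_univ s))
      have h4 : ζ * Zp ≤ D / (2 + Zp) * Zp := mul_le_mul_of_nonneg_right hζ1 hZ
      have h5 : D / (2 + Zp) + D / (2 + Zp) + D / (2 + Zp) * Zp = D := by field_simp; ring
      linarith
  have hfin := hbound s k le_rfl hgood
  have hpos : 0 ≤ ∑ s', M.weight πs s s' * W.bregman (πs s').1 (π k ω s').1 :=
    Finset.sum_nonneg fun s' _ => mul_nonneg (M.weight_nonneg πs s s') (hbreg k le_rfl s')
  have heq : D / (2 + Zp) + (ζ * (1 / (1 - M.γ))) ^ 2 / (2 * μ) + ζ * Zp =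
      η * (1 - M.γ) * (k * M.gapBound μ D Zp k) := by
    rw [MDP.gapBound, ← hζdef, hη]
    nth_rewrite 2 [← hsk2]
    field_simp
  rw [heq] at hfin
  have hpos2 : 0 < η * (1 - M.γ) := by positivity
  exact le_of_mul_le_mul_left (by linarith) hpos2

/-- The minimum is at most the average over the iterates. The bounds hold for every start state, so
they may be averaged over any `ϑ` outside the probabilistic event. -/
lemma MDP.objective_gap_le {ϑ : S → ℝ} (hϑ : ϑ ∈ stdSimplex ℝ S) (hk : 0 < k)
    {p : ℕ → Policy S A} {πs πs' : Policy S A} (hle : ∀ s, M.value πs' s ≤ M.value πs s) {b : ℝ}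
    (hb : ∀ s, ∑ t ∈ Finset.range k, (M.value (p t) s - M.value πs' s) ≤ k * b) :
    (⨅ t : Fin k, M.objective ϑ (p t)) - M.objective ϑ πs ≤ b := by
  have hk' : (0 : ℝ) < k := by exact_mod_cast hk
  have hobj : M.objective ϑ πs' ≤ M.objective ϑ πs :=
    Finset.sum_le_sum fun s _ => mul_le_mul_of_nonneg_left (hle s) (hϑ.1 s)
  have hsum : ∑ t ∈ Finset.range k, (M.objective ϑ (p t) - M.objective ϑ πs') ≤ k * b := by
    calc _ = ∑ s, ϑ s * ∑ t ∈ Finset.range k, (M.value (p t) s - M.value πs' s) := by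
          simp only [MDP.objective, Finset.mul_sum]
          rw [Finset.sum_comm]
          simp only [← Finset.sum_sub_distrib, mul_sub]
      _ ≤ ∑ s, ϑ s * (k * b) :=
          Finset.sum_le_sum fun s _ => mul_le_mul_of_nonneg_left (hb s) (hϑ.1 s)
      _ = k * b := by rw [← Finset.sum_mul, hϑ.2, one_mul]
  have hinf : k * (⨅ t : Fin k, M.objective ϑ (p t)) ≤
      ∑ t ∈ Finset.range k, M.objective ϑ (p t) := by
    have := Finset.card_nsmul_le_sum (Finset.range k) (fun t => M.objective ϑ (p t))
      (⨅ t : Fin k, M.objective ϑ (p t)) fun t ht =>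
        ciInf_le (f := fun t : Fin k => M.objective ϑ (p t)) (Set.finite_range _).bddBelow
          ⟨t, Finset.mem_range.1 ht⟩
    rwa [Finset.card_range, nsmul_eq_mul] at this
  rw [Finset.sum_sub_distrib, Finset.sum_const, Finset.card_range, nsmul_eq_mul] at hsum
  have h1 := mul_le_mul_of_nonneg_left hobj hk'.le
  exact le_of_mul_le_mul_left (by linarith) hk'

lemma GapWithProb.mono {δ b b' : ℝ} (h : GapWithProb M k δ b ℙ π) (hb : b ≤ b') :
    GapWithProb M k δ b' ℙ π :=
  h.trans (measure_mono fun _ hω ϑ hϑ πs hπs => (hω ϑ hϑ πs hπs).trans hb)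

lemma MDP.Zpar_nonneg (M : MDP S A) (k : ℕ) (δ : ℝ) : 0 ≤ M.Zpar k δ :=
  div_nonneg (by positivity) M.one_sub_γ_pos.le

lemma DivergenceCondition.threshold_mem {μ : ℝ} {τ : ℝ → ℝ} (hD : DivergenceCondition M W μ τ)
    {D : ℝ} (hD0 : 0 < D) : threshold A τ D ∈ Set.Ioc 0 1 := by
  have hA : (1 : ℝ) ≤ Fintype.card A := by exact_mod_cast Fintype.card_pos
  refine ⟨lt_min (hD.tau_pos D hD0) (by positivity), (min_le_right _ _).trans ?_⟩
  rw [div_le_one (by linarith)]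
  exact hA

/-- The optimality gap after `k` iterations, with high probability. -/
lemma IsRun.gapWithProb [IsProbabilityMeasure ℙ] {μ : ℝ} {τ : ℝ → ℝ} {D δ C ρ νmin : ℝ}
    (h : IsRun M W (M.zeta μ D (M.Zpar k δ) / √k) (threshold A τ D) n k π₀ ℙ Z π)
    (hD : DivergenceCondition M W μ τ) (hk : 0 < k) (hD0 : 0 < D) (hδ : 0 < δ) (hδ1 : δ < 1)
    (hC : 0 < C) (hρ : 0 < ρ) (hρ1 : ρ < 1) (hν : 0 < νmin) (hπ₀ : π₀.IsInterior)
    (hDπ : ∀ (s : S) (πs : Policy S A), M.IsOptimal πs → πs.IsDeterministic →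
      (2 + M.Zpar k δ) * W.bregman (πs s).1 (π₀ s).1 ≤ D)
    (hn : 10 * M.lengthOrder C ρ νmin (threshold A τ D) (M.epsPar k δ) ≤ n)
    (hmix : UniformMixing M C ρ νmin k ℙ π) :
    GapWithProb M k δ (M.gapBound μ D (M.Zpar k δ) k) ℙ π := by
  unfold GapWithProb
  -- Without an optimal policy the claim is vacuous at every outcome.
  by_cases hex : ∃ πs, M.IsOptimal πs
  swap
  · have : {ω | ∀ ϑ ∈ stdSimplex ℝ S, ∀ πs : Policy S A, M.IsOptimal πs →
        (⨅ t : Fin k, M.objective ϑ (π t ω)) - M.objective ϑ πs ≤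
          M.gapBound μ D (M.Zpar k δ) k} = Set.univ :=
      Set.eq_univ_of_forall fun ω ϑ _ πs hπs => absurd ⟨πs, hπs⟩ hex
    rw [this, measure_univ, ENNReal.ofReal_le_one]
    linarith
  obtain ⟨π', hπ'⟩ := hex
  obtain ⟨πs, f, hopt, hf⟩ := M.exists_deterministic_optimal hπ'
  obtain ⟨hθ, hθ1⟩ := hD.threshold_mem hD0
  set U := {ω | ∀ ϑ ∈ stdSimplex ℝ S, ∀ πs : Policy S A, M.IsOptimal πs →
    (⨅ t : Fin k, M.objective ϑ (π t ω)) - M.objective ϑ πs ≤ M.gapBound μ D (M.Zpar k δ) k}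
  let bad : S → ℕ → Set Ω := fun s j => {ω | M.Zpar k δ * √k < ∑ t ∈ Finset.range (j + 1),
    M.noise πs f C ρ νmin (threshold A τ D) n s (π t ω) fun l => Z t l ω}
  have hsub : Uᶜ ⊆ {ω | ¬ ∀ t < k, M.MixesWith (π t ω) C ρ νmin} ∪
      ⋃ s ∈ (Finset.univ : Finset S), ⋃ j ∈ Finset.range k, bad s j := by
    intro ω hω
    by_contra hcon
    simp only [Set.mem_union, Set.mem_ofPred_eq, Set.mem_iUnion, not_or, not_not, not_exists,
      Finset.mem_univ, Finset.mem_range, bad, not_lt, true_imp_iff] at hcon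
    refine hω fun ϑ hϑ πs' hπs' => MDP.objective_gap_le (p := fun t => π t ω) hϑ hk (hopt πs') ?_
    exact h.regret_le hD hk hD0 (M.Zpar_nonneg k δ) hπ₀ hf hopt
      (fun s => hDπ s πs hopt fun s => ⟨f s, hf s⟩) ω hcon.1 hcon.2
  have hbad : ℙ Uᶜ ≤ ENNReal.ofReal δ := by
    refine (measure_mono hsub).trans ((measure_union_le _ _).trans ?_)
    rw [show ℙ {ω | ¬ ∀ t < k, M.MixesWith (π t ω) C ρ νmin} = 0 from hmix, zero_add]
    calc _ ≤ ∑ s : S, ∑ j ∈ Finset.range k, ℙ (bad s j) :=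
          (measure_biUnion_finset_le _ _).trans
            (Finset.sum_le_sum fun s _ => measure_biUnion_finset_le _ _)
      _ ≤ ∑ s : S, ∑ j ∈ Finset.range k, ENNReal.ofReal (δ / (Fintype.card S * k)) :=
          Finset.sum_le_sum fun s _ => Finset.sum_le_sum fun j hj =>
            h.measure_noise_gt_le hC hρ hρ1 hν hθ hθ1 hk hδ hδ1 hf hn s
              (Nat.succ_le_of_lt (Finset.mem_range.1 hj))
      _ = ENNReal.ofReal δ := by
          simp only [Finset.sum_const, Finset.card_range, Finset.card_univ, ← ENNReal.ofReal_nsmul]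
          congr 1
          have h1 : (0 : ℝ) < k := by exact_mod_cast hk
          have h2 : (0 : ℝ) < Fintype.card S := by exact_mod_cast Fintype.card_pos
          simp only [nsmul_eq_mul]
          field_simp
  -- Subadditivity suffices here, so `U` need not be shown measurable.
  have huniv : (1 : ENNReal) ≤ ℙ U + ENNReal.ofReal δ := by
    rw [← measure_univ (μ := ℙ)]
    exact (measure_univ_le_add_compl U).trans (add_le_add le_rfl hbad)
  rw [ENNReal.ofReal_sub _ hδ.le, ENNReal.ofReal_one]
  exact tsub_le_iff_right.2 huniv

end Regret

/-! ### Number of iterations for a prescribed accuracy -/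

section Complexity

variable {S A : Type*} [Fintype S] [DecidableEq S] [Nonempty S] [Fintype A] [Nonempty A]

lemma MDP.zeta_pos (M : MDP S A) {μ D Z : ℝ} (hμ : 0 < μ) (hD : 0 < D) (hZ : 0 ≤ Z) :
    0 < M.zeta μ D Z := by
  have := M.one_sub_γ_pos
  exact lt_min (Real.sqrt_pos.2 (by positivity)) (by positivity)

/-- The gap bound is `(a + b + c) / √k` while `iterConst` is `a ^ 2 + b ^ 2 + c ^ 2`; the factor `3`
is from Cauchy–Schwarz. -/
lemma MDP.gapBound_le (M : MDP S A) {μ D Z ε : ℝ} {k : ℕ} (hμ : 0 < μ) (hD : 0 < D) (hZ : 0 ≤ Z)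
    (hε : 0 < ε) (hk : 0 < k) (h : 3 * (M.iterConst μ D Z / ε ^ 2) ≤ k) :
    M.gapBound μ D Z k ≤ ε := by
  have hg := M.one_sub_γ_pos
  have hζ := M.zeta_pos hμ hD hZ
  have hk' : (0 : ℝ) < k := by exact_mod_cast hk
  have hsk : 0 < √(k : ℝ) := Real.sqrt_pos.2 hk'
  have hsk2 : √(k : ℝ) ^ 2 = k := Real.sq_sqrt hk'.le
  set a := D / ((2 + Z) * M.zeta μ D Z * (1 - M.γ)) with ha
  set b := M.zeta μ D Z * (1 / (1 - M.γ)) ^ 2 / (2 * μ * (1 - M.γ)) with hb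
  set c := Z / (1 - M.γ) with hc
  have h1 : M.gapBound μ D Z k = (a + b + c) / √k := by
    rw [MDP.gapBound, ha, hb, hc, add_div, add_div, div_div, div_div, div_div]
  have h2 : M.iterConst μ D Z = c ^ 2 + (b ^ 2 + a ^ 2) := by
    rw [MDP.iterConst, MDP.detConst, ha, hb, hc]
    generalize 1 - M.γ = g
    generalize 2 + Z = d
    ring
  rw [h1, div_le_iff₀ hsk]
  have h3 : 3 * M.iterConst μ D Z ≤ k * ε ^ 2 := by
    rwa [← mul_div_assoc, div_le_iff₀ (by positivity)] at h
  have h4 : (a + b + c) ^ 2 ≤ (ε * √k) ^ 2 := by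
    rw [mul_pow, hsk2]
    rw [h2] at h3
    nlinarith [sq_nonneg (a - b), sq_nonneg (a - c), sq_nonneg (b - c)]
  exact le_of_sq_le_sq h4 (by positivity)

/-- The scaling `D = (2 + Z) * D₀` cancels `Z`, so the stepsize constant does not depend on `k`
through `Z`. -/
lemma MDP.zeta_scaled (M : MDP S A) (μ D₀ : ℝ) {Z : ℝ} (hZ : 0 ≤ Z) :
    M.zeta μ ((2 + Z) * D₀) Z = M.zeta μ (2 * D₀) 0 := by
  have hg := M.one_sub_γ_pos
  unfold MDP.zeta
  congr 1
  · congr 1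
    field_simp
    ring
  · field_simp
    ring

lemma MDP.detConst_scaled (M : MDP S A) (μ D₀ : ℝ) {Z : ℝ} (hZ : 0 ≤ Z) :
    M.detConst μ ((2 + Z) * D₀) Z = M.detConst μ (2 * D₀) 0 := by
  unfold MDP.detConst
  rw [M.zeta_scaled μ D₀ hZ]
  congr 1
  have : (2 + Z) ≠ 0 := by positivity
  rw [mul_pow, mul_pow, mul_assoc, mul_assoc, mul_div_mul_left _ _ (by positivity), add_zero,
    mul_div_mul_left _ _ (by positivity)]

lemma MDP.detConst_nonneg (M : MDP S A) (μ D Z : ℝ) : 0 ≤ M.detConst μ D Z := by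
  unfold MDP.detConst
  positivity

lemma log_le_two_mul_sqrt {x : ℝ} (hx : 0 < x) : 1 + Real.log x ≤ 2 * √x := by
  have h := Real.log_le_sub_one_of_pos (Real.sqrt_pos.2 hx)
  rw [Real.log_sqrt hx.le] at h
  linarith

/-- A self-consistent choice of the number of iterations when the required number depends on
itself logarithmically. -/
lemma exists_iteration_count {u E ε y : ℝ} (hu : 0 < u) (hE : 0 ≤ E) (hε : 0 < ε) (hy : 1 < y) :
    ∃ k : ℕ, 0 < k ∧ 3 * ((16 * u * Real.log (y * k) + E) / ε ^ 2) ≤ k ∧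
      (k : ℝ) ≤ 6 * max 1 ((16 * u * Real.log (y * k) + E) / ε ^ 2) ∧
      Real.log (y * k) ≤ 18 * Real.log (2 + y * (1 + (u + E) / ε ^ 2)) := by
  classical
  -- The left side grows at most like `c * √k`, because the logarithm is bounded by a square root;
  -- any `k ≥ max 1 (c ^ 2)` therefore works.
  have hex : ∃ k : ℕ, 0 < k ∧ 3 * ((16 * u * Real.log (y * k) + E) / ε ^ 2) ≤ k := by
    set c := 3 * (32 * u * √y + E) / ε ^ 2 with hc
    have hc0 : 0 ≤ c := by positivity
    refine ⟨⌈c ^ 2⌉₊ + 1, by omega, ?_⟩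
    have hck : c ^ 2 ≤ ((⌈c ^ 2⌉₊ + 1 : ℕ) : ℝ) := by
      push_cast; linarith [Nat.le_ceil (c ^ 2)]
    have hk1 : (1 : ℝ) ≤ ((⌈c ^ 2⌉₊ + 1 : ℕ) : ℝ) := by
      exact_mod_cast Nat.le_add_left 1 _
    generalize ((⌈c ^ 2⌉₊ + 1 : ℕ) : ℝ) = κ at hck hk1 ⊢
    have hs1 : 1 ≤ √κ := Real.one_le_sqrt.2 hk1
    have hs2 : c ≤ √κ := Real.le_sqrt_of_sq_le hck
    have hs3 : √κ * √κ = κ := Real.mul_self_sqrt (by linarith)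
    have hlog := log_le_two_mul_sqrt (x := y * κ) (by positivity)
    rw [Real.sqrt_mul (by linarith)] at hlog
    have h1 : 16 * u * Real.log (y * κ) + E ≤ (32 * u * √y + E) * √κ := by
      have h2 : 16 * u * Real.log (y * κ) ≤ 16 * u * (2 * (√y * √κ)) :=
        mul_le_mul_of_nonneg_left (by linarith) (by positivity)
      have h3 : E ≤ E * √κ := le_mul_of_one_le_right hE hs1
      linarith
    calc 3 * ((16 * u * Real.log (y * κ) + E) / ε ^ 2)
        ≤ 3 * ((32 * u * √y + E) * √κ / ε ^ 2) := by gcongr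
      _ = c * √κ := by rw [hc]; ring
      _ ≤ √κ * √κ := mul_le_mul_of_nonneg_right hs2 (Real.sqrt_nonneg _)
      _ = κ := hs3
  -- The least admissible `k` is taken: if `k ≥ 2`, failure at `k - 1 ≥ k / 2` bounds `k` by twice
  -- the required order, giving the factor `6`.
  obtain ⟨hk0, hk3⟩ := Nat.find_spec hex
  have hmin := fun m (hm : m < Nat.find hex) => Nat.find_min hex hm
  set k := Nat.find hex
  have hX : 0 < (u + E) / ε ^ 2 := by positivity
  have hy0 : 0 < y := by linarith
  have hW : 0 < Real.log (2 + y * (1 + (u + E) / ε ^ 2)) :=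
    Real.log_pos (by have : 0 < y * (1 + (u + E) / ε ^ 2) := by positivity
                     linarith)
  refine ⟨k, hk0, hk3, ?_⟩
  rcases Nat.lt_or_ge 1 k with hk1 | hk1
  swap
  · obtain hk : k = 1 := by omega
    rw [hk]
    constructor
    · have := le_max_left 1 ((16 * u * Real.log (y * (1 : ℕ)) + E) / ε ^ 2)
      push_cast at this ⊢
      linarith
    · have : Real.log (y * (1 : ℕ)) ≤ Real.log (2 + y * (1 + (u + E) / ε ^ 2)) := by
        refine Real.log_le_log (by simpa using hy0) ?_
        push_cast
        nlinarith [mul_pos hy0 hX]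
      linarith
  have hk' : (0 : ℝ) < k := by exact_mod_cast hk0
  have hlt := hmin (k - 1) (by omega)
  rw [not_and, not_le] at hlt
  have hlt := hlt (by omega)
  have hcast : ((k - 1 : ℕ) : ℝ) = k - 1 := by rw [Nat.cast_sub hk0]; simp
  have hk2 : (2 : ℝ) ≤ k := by exact_mod_cast hk1
  rw [hcast] at hlt
  have hlogmono : Real.log (y * (k - 1)) ≤ Real.log (y * k) :=
    Real.log_le_log (mul_pos hy0 (by linarith)) (mul_le_mul_of_nonneg_left (by linarith) hy0.le)
  have hk6 : (k : ℝ) ≤ 6 * ((16 * u * Real.log (y * k) + E) / ε ^ 2) := by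
    have : 3 * ((16 * u * Real.log (y * (k - 1)) + E) / ε ^ 2) ≤
        3 * ((16 * u * Real.log (y * k) + E) / ε ^ 2) := by gcongr
    linarith
  refine ⟨hk6.trans (mul_le_mul_of_nonneg_left (le_max_right _ _) (by norm_num)), ?_⟩
  have hyk : 0 < y * k := by positivity
  have hyk1 : 1 ≤ y * k := by nlinarith
  have hlog0 : 0 ≤ Real.log (y * k) := Real.log_nonneg hyk1
  have hsq : √(y * k) * √(y * k) = y * k := Real.mul_self_sqrt hyk.le
  have hs0 : 0 < √(y * k) := Real.sqrt_pos.2 hyk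
  -- Bounding the logarithm by `√(y * k)` makes the inequality for `k` solvable, which removes `k`
  -- from the right side.
  have h1 : (k : ℝ) ≤ 192 * ((u + E) / ε ^ 2) * √(y * k) := by
    have h2 : 16 * u * Real.log (y * k) + E ≤ 16 * (u + E) * (1 + Real.log (y * k)) := by
      nlinarith [mul_nonneg hE hlog0]
    have h3 : 16 * (u + E) * (1 + Real.log (y * k)) ≤ 16 * (u + E) * (2 * √(y * k)) :=
      mul_le_mul_of_nonneg_left (log_le_two_mul_sqrt hyk) (by positivity)
    calc (k : ℝ) ≤ 6 * ((16 * u * Real.log (y * k) + E) / ε ^ 2) := hk6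
      _ ≤ 6 * (16 * (u + E) * (2 * √(y * k)) / ε ^ 2) := by gcongr; exact h2.trans h3
      _ = _ := by ring
  have h2 : √(y * k) ≤ 192 * (y * ((u + E) / ε ^ 2)) := by
    refine le_of_mul_le_mul_right ?_ hs0
    rw [hsq]
    calc y * k ≤ y * (192 * ((u + E) / ε ^ 2) * √(y * k)) :=
          mul_le_mul_of_nonneg_left h1 hy0.le
      _ = _ := by ring
  have hbase : 2 ≤ 2 + y * (1 + (u + E) / ε ^ 2) := by
    have : 0 < y * (1 + (u + E) / ε ^ 2) := by positivity
    linarith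
  -- `192 ≤ 2 ^ 8` is absorbed into eight further powers of a base that is at least `2`; the ninth
  -- power under a square root yields the factor `18`.
  have h3 : √(y * k) ≤ (2 + y * (1 + (u + E) / ε ^ 2)) ^ 9 := by
    have h4 : (2 : ℝ) ^ 8 ≤ (2 + y * (1 + (u + E) / ε ^ 2)) ^ 8 :=
      pow_le_pow_left₀ (by norm_num) hbase 8
    have h5 : y * ((u + E) / ε ^ 2) ≤ 2 + y * (1 + (u + E) / ε ^ 2) := by linarith
    calc √(y * k) ≤ 192 * (y * ((u + E) / ε ^ 2)) := h2
      _ ≤ (2 + y * (1 + (u + E) / ε ^ 2)) ^ 8 * (2 + y * (1 + (u + E) / ε ^ 2)) :=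
          mul_le_mul (by linarith) h5 (by positivity) (by positivity)
      _ = _ := by ring
  have h4 := Real.log_le_log hs0 h3
  rw [Real.log_sqrt hyk.le, Real.log_pow] at h4
  push_cast at h4
  linarith

/-- After the scaling, `k` enters only through the logarithm in `Z ^ 2`; this is the form treated by
`exists_iteration_count`. -/
lemma MDP.iterConst_scaled (M : MDP S A) (μ D₀ : ℝ) {k : ℕ} (hk : 0 < k) {δ : ℝ} (hδ : 0 < δ)
    (hδ1 : δ < 1) : M.iterConst μ ((2 + M.Zpar k δ) * D₀) (M.Zpar k δ) =
      16 * (1 / (1 - M.γ) ^ 4) * Real.log (Fintype.card S / δ * k) +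
        M.detConst μ (2 * D₀) 0 := by
  have hl := (Real.log_pos (one_lt_card_mul_div S hk hδ hδ1)).le
  have hg := M.one_sub_γ_pos
  rw [MDP.iterConst, M.detConst_scaled μ D₀ (M.Zpar_nonneg k δ), MDP.Zpar, div_pow, mul_pow,
    Real.sq_sqrt hl, div_mul_eq_mul_div]
  congr 1
  field_simp
  ring

end Complexity

end SPMD

end

/-! ### Assembly of the theorem -/

open MeasureTheory SPMD in
theorem mainTheorem1 :
    -- universal constants hidden in the Θ-notation
    ∃ K₁ K₂ K₃ : ℝ, 0 < K₁ ∧ 0 < K₂ ∧ 0 < K₃ ∧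
    ∀ (S : Type*) (A : Type*) [Fintype S] [DecidableEq S] [Nonempty S] [Fintype A] [Nonempty A]
      (M : MDP S A) (W : DistGen A) (μ : ℝ) (τ : ℝ → ℝ) (_ : DivergenceCondition M W μ τ)
      (C ρ νmin : ℝ) (_ : 0 < C) (_ : 0 < ρ) (_ : ρ < 1) (_ : 0 < νmin)
      (π₀ : Policy S A) (_ : π₀.IsInterior) (δ : ℝ) (_ : 0 < δ) (_ : δ < 1),
    -- convergence with high probability, for any number of iterations fixed in advance
    (∀ (k : ℕ) (_ : 0 < k) (D : ℝ) (_ : 0 < D)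
      (_ : ∀ (s : S) (πs : Policy S A), M.IsOptimal πs → πs.IsDeterministic →
        (2 + M.Zpar k δ) * W.bregman (πs s).1 (π₀ s).1 ≤ D)
      (n : ℕ)
      (_ : K₁ * M.lengthOrder C ρ νmin (threshold A τ D) (M.epsPar k δ) ≤ n)
      (Ω : Type*) [MeasurableSpace Ω] (ℙ : Measure Ω) [IsProbabilityMeasure ℙ]
      (Z : ℕ → ℕ → Ω → S × A) (π : ℕ → Ω → Policy S A)
      (_ : IsRun M W (M.zeta μ D (M.Zpar k δ) / √k) (threshold A τ D) n k π₀ ℙ Z π)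
      (_ : UniformMixing M C ρ νmin k ℙ π),
      GapWithProb M k δ (M.gapBound μ D (M.Zpar k δ) k) ℙ π ∧
      -- accuracy `ε` is attained as soon as `k` reaches the order `iterConst / ε²`
      ∀ ε : ℝ, 0 < ε → K₂ * (M.iterConst μ D (M.Zpar k δ) / ε ^ 2) ≤ k →
        GapWithProb M k δ ε ℙ π) ∧
    -- iteration and sample complexity: for every target accuracy there are a number `k` of
    -- iterations and a trajectory length `n` of the stated orders that suffice; `D₀` plays the
    -- role of `D / (2 + Z)`
    (∀ (D₀ : ℝ) (_ : 0 < D₀)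
      (_ : ∀ (s : S) (πs : Policy S A), M.IsOptimal πs → πs.IsDeterministic →
        W.bregman (πs s).1 (π₀ s).1 ≤ D₀)
      (ε : ℝ) (_ : 0 < ε),
      ∃ (k n : ℕ) (Zk D θ : ℝ), 0 < k ∧
        Zk = M.Zpar k δ ∧ D = (2 + Zk) * D₀ ∧ θ = threshold A τ D ∧
        n = ⌈K₁ * M.lengthOrder C ρ νmin θ (M.epsPar k δ)⌉₊ ∧
        -- number of iterations
        K₂ * (M.iterConst μ D Zk / ε ^ 2) ≤ k ∧
        k ≤ K₃ * max 1 (M.iterConst μ D Zk / ε ^ 2) ∧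
        -- the `k` inside `Zk` only contributes logarithmic factors
        Real.log (Fintype.card S * k / δ) ≤ K₃ * Real.log (2 + Fintype.card S / δ *
          (1 + (1 / (1 - M.γ) ^ 4 + M.detConst μ D Zk) / ε ^ 2)) ∧
        -- total number of samples
        (n * k : ℝ) ≤ K₃ * (M.lengthOrder C ρ νmin θ (M.epsPar k δ) *
          max 1 (M.iterConst μ D Zk / ε ^ 2)) ∧
        -- accuracy `ε` with probability at least `1 - δ`
        ∀ (Ω : Type*) [MeasurableSpace Ω] (ℙ : Measure Ω) [IsProbabilityMeasure ℙ]
          (Z : ℕ → ℕ → Ω → S × A) (π : ℕ → Ω → Policy S A),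
          IsRun M W (M.zeta μ D Zk / √k) θ n k π₀ ℙ Z π →
          UniformMixing M C ρ νmin k ℙ π →
          GapWithProb M k δ ε ℙ π) := by
  -- `10` comes from the block count, `3` from squaring a sum of three terms, and `72 = 12 * 6` from
  -- the rounded length `n ≤ 12 * L` times the bound on `k`; it also exceeds `18`, the logarithmic
  -- factor.
  refine ⟨10, 3, 72, by norm_num, by norm_num, by norm_num, ?_⟩
  intro S A _ _ _ _ _ M W μ τ hD C ρ νmin hC hρ hρ1 hν π₀ hπ₀ δ hδ hδ1
  refine ⟨?_, ?_⟩
  · intro k hk D hD0 hDπ n hn Ω _ ℙ _ Z π hrun hmix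
    have hgap := hrun.gapWithProb hD hk hD0 hδ hδ1 hC hρ hρ1 hν hπ₀ hDπ hn hmix
    exact ⟨hgap, fun ε hε hkε =>
      hgap.mono (M.gapBound_le hD.mu_pos hD0 (M.Zpar_nonneg k δ) hε hk hkε)⟩
  · intro D₀ hD₀ hDπ ε hε
    have hg := M.one_sub_γ_pos
    have hy : 1 < (Fintype.card S : ℝ) / δ := by
      simpa using one_lt_card_mul_div S one_pos hδ hδ1
    obtain ⟨k, hk, hk3, hk6, hlog⟩ := exists_iteration_count
      (u := 1 / (1 - M.γ) ^ 4) (E := M.detConst μ (2 * D₀) 0) (by positivity)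
      (M.detConst_nonneg _ _ _) hε hy
    have hZ := M.Zpar_nonneg k δ
    rw [← M.iterConst_scaled μ D₀ hk hδ hδ1] at hk3 hk6
    have hD0 : 0 < (2 + M.Zpar k δ) * D₀ := by positivity
    obtain ⟨hθ, hθ1⟩ := hD.threshold_mem hD0
    have hL := M.lengthOrder_pos (C := C) (ρ := ρ) hν hθ (M.epsPar_pos hk hδ hδ1)
    refine ⟨k, _, _, _, _, hk, rfl, rfl, rfl, rfl, hk3, ?_, ?_, ?_, ?_⟩
    · refine hk6.trans (mul_le_mul_of_nonneg_right (by norm_num) ?_)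
      exact zero_le_one.trans (le_max_left _ _)
    · rw [M.detConst_scaled μ D₀ hZ, ← div_mul_eq_mul_div]
      refine hlog.trans (mul_le_mul_of_nonneg_right (by norm_num) (Real.log_nonneg ?_))
      have := M.detConst_nonneg μ (2 * D₀) 0
      have : 0 ≤ (Fintype.card S : ℝ) / δ *
          (1 + (1 / (1 - M.γ) ^ 4 + M.detConst μ (2 * D₀) 0) / ε ^ 2) := by positivity
      linarith
    · set L := M.lengthOrder C ρ νmin (threshold A τ ((2 + M.Zpar k δ) * D₀)) (M.epsPar k δ)
      have hn : (⌈10 * L⌉₊ : ℝ) ≤ 12 * L := by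
        have := Nat.ceil_lt_add_one (a := 10 * L) (by linarith)
        linarith
      refine (mul_le_mul hn hk6 (Nat.cast_nonneg k) (by linarith)).trans_eq ?_
      ring
    · intro Ω _ ℙ _ Z π hrun hmix
      refine (hrun.gapWithProb hD hk hD0 hδ hδ1 hC hρ hρ1 hν hπ₀ ?_ (Nat.le_ceil _) hmix).mono
        (M.gapBound_le hD.mu_pos hD0 hZ hε hk hk3)
      exact fun s πs h1 h2 => mul_le_mul_of_nonneg_left (hDπ s πs h1 h2) (by linarith)
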